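/- Let $K$ be an infinite field of characteristic $\neq 2$, and let $K\langle X\rangle$ be the free unital associative algebra on countably many indeterminates $x_i, x_i^*$, with the involution $*$ that reverses words and exchanges $x_i$ and $x_i^*$. Put $y_i=\frac{x_i+x_i^*}{2}$, $z_i=\frac{x_i-x_i^*}{2}$, $[a,b]=ab-ba$, $[a_1,\dots,a_n]=[[a_1,\dots,a_{n-1}],a_n]$ and $a\circ b=\frac12(ab+ba)$. The $*$-proper polynomials are the elements of the unital subalgebra generated by all $z_i$ and all commutators $[a_1,\dots,a_n]$ with $n\ge 2$ and each $a_j$ one of the $y_i$ or $z_i$. A $*$-space is a $K$-subspace of $K\langle X\rangle$ invariant under all unital algebra endomorphisms that commute with $*$; the $*$-space generated by a set is the smallest $*$-space containing it. Let $E=E_0\oplus E_1$ be the Grassmann algebra over $K$ of a vector space of countably infinite dimension, with $E_0$, $E_1$ spanned by the monomials of even, respectively odd, length, and let $$R=M_{1,1}(E)=\left\{\begin{pmatrix} a&b\\ c&d\end{pmatrix} : a,d\in E_0,\ b,c\in E_1\right\},\qquad \begin{pmatrix} a&b\\ c&d\end{pmatrix}^{*}=\begin{pmatrix} d&b\\ -c&a\end{pmatrix}.$$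 Let $T_*(R)$ be the set of all $f\in K\langle X\rangle$ that vanish under every substitution $x_i\mapsto a_i$, $x_i^*\mapsto a_i^*$ with $a_i\in R$, and call $f$ $*$-central for $R$ if all values of $f$ under such substitutions lie in the center of $R$. For $n,l\ge 1$ put $G_n=(z_1\circ z_2)(z_3\circ z_4)\cdots(z_{2n-1}\circ z_{2n})$ and $C_l=\sum_{i=1}^{l+1}(-1)^iP_i$, where $P_1=[y_2,z_1,z_2][y_3,z_3]\cdots[y_{l+1},z_{l+1}]$ and, for $1<i\le l+1$, $$P_i=[y_2,z_i,z_1]\,[y_3,z_2]\cdots[y_i,z_{i-1}]\,[y_{i+1},z_{i+1}]\cdots[y_{l+1},z_{l+1}].$$ Let $W$ be the $*$-space generated by all $G_n$, $C_l$ and $C_lG_n$ ($n,l\ge1$). Let $V$ be the $*$-space generated by $T_*(R)$, by $z_1\circ z_2$, by $[y_1,z_1,z_2]-2(z_1z_2+z_2z_1)y_1$ and, if $\operatorname{char}K=p>2$, also by $y_1^p$. Let $w\in K\langle X\rangle$ be a $*$-proper polynomial that is $*$-central for $R$. If $w$ has zero constant term, then there is $g\in W$ with $w-g\in T_*(R)$,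 and $w$ lies in $V$. If $\operatorname{char}K>2$, then $w$ lies in $V$ whatever its constant term is. -/

import Mathlib

noncomputable section

namespace StarM11

/-! ### The free algebra with involution -/

section Free

variable (K : Type*) [Field K]

/-- The free associative unital algebra `K⟨X⟩` on the indeterminates `x_i` (`Sum.inl i`) and
`x_i^*` (`Sum.inr i`). -/
abbrev StarPoly : Type _ := FreeAlgebra K (ℕ ⊕ ℕ)

/-- The endomorphism of `K⟨X⟩` that exchanges `x_i` and `x_i^*`. -/
def swapHom : StarPoly K →ₐ[K] StarPoly K :=
  FreeAlgebra.lift K (fun s : ℕ ⊕ ℕ => FreeAlgebra.ι K s.swap)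

variable {K} in
/-- The canonical involution on `K⟨X⟩`: the reversal involution (which is Mathlib's `star` on a
free algebra) composed with the exchange of `x_i` and `x_i^*`. -/
def canInv (f : StarPoly K) : StarPoly K := star (swapHom K f)

/-- The symmetric variable `y_i = (x_i + x_i^*) / 2`. -/
def y (i : ℕ) : StarPoly K :=
  (2⁻¹ : K) • (FreeAlgebra.ι K (Sum.inl i) + FreeAlgebra.ι K (Sum.inr i))

/-- The skew-symmetric variable `z_i = (x_i - x_i^*) / 2`. -/
def z (i : ℕ) : StarPoly K :=
  (2⁻¹ : K) • (FreeAlgebra.ι K (Sum.inl i) - FreeAlgebra.ι K (Sum.inr i))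

variable {K} in
/-- The Jordan product `a ∘ b = (ab + ba) / 2`. -/
def jordan (a b : StarPoly K) : StarPoly K := (2⁻¹ : K) • (a * b + b * a)

variable {K} in
/-- The left-normed commutator `[a, b_1, …, b_k] = [[a, b_1, …, b_{k-1}], b_k]`, where
`⁅u, v⁆ = u * v - v * u`. -/
def leftComm (a : StarPoly K) (l : List (StarPoly K)) : StarPoly K :=
  l.foldl (fun u v => ⁅u, v⁆) a

/-- The set `Y ∪ Z` of all variables `y_i` and `z_i`. -/
def yzVars : Set (StarPoly K) := Set.range (y K) ∪ Set.range (z K)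

/-- The algebra of `*`-proper polynomials: the (unital) subalgebra generated by `Z` and all
left-normed commutators of length at least `2` in elements of `Y ∪ Z`. -/
def properAlg : Subalgebra K (StarPoly K) :=
  Algebra.adjoin K (Set.range (z K) ∪
    {f | ∃ a ∈ yzVars K, ∃ l : List (StarPoly K),
      l ≠ [] ∧ (∀ b ∈ l, b ∈ yzVars K) ∧ f = leftComm a l})

variable {K} in
/-- A `*`-space: a subspace of `K⟨X⟩` invariant under all `*`-endomorphisms. -/
def IsStarSpace (U : Submodule K (StarPoly K)) : Prop :=
  ∀ φ : StarPoly K →ₐ[K] StarPoly K, (∀ f, φ (canInv f) = canInv (φ f)) →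
    ∀ f ∈ U, φ f ∈ U

variable {K} in
/-- The `*`-space generated by `S`: the intersection of all `*`-spaces containing `S`. -/
def starSpan (S : Set (StarPoly K)) : Submodule K (StarPoly K) :=
  sInf {U | IsStarSpace U ∧ S ⊆ U}

end Free

/-! ### The algebra `R = M_{1,1}(E)` and its involution -/

section Algebra

variable (K : Type*) [Field K]

/-- The Grassmann algebra of a vector space with a countable basis `e_0, e_1, …`. -/
abbrev Grassmann : Type _ := ExteriorAlgebra K (ℕ →₀ K)

/-- The span `E_0` of the monomials of even length. -/
def E0 : Submodule K (Grassmann K) :=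
  CliffordAlgebra.evenOdd (0 : QuadraticForm K (ℕ →₀ K)) 0

/-- The span `E_1` of the monomials of odd length. -/
def E1 : Submodule K (Grassmann K) :=
  CliffordAlgebra.evenOdd (0 : QuadraticForm K (ℕ →₀ K)) 1

variable {K} in
theorem mul_mem_00 {a b : Grassmann K} (ha : a ∈ E0 K) (hb : b ∈ E0 K) : a * b ∈ E0 K := by
  have h := CliffordAlgebra.evenOdd_mul_le (0 : QuadraticForm K (ℕ →₀ K)) 0 0
    (Submodule.mul_mem_mul ha hb)
  simpa [E0] using h

variable {K} in
theorem mul_mem_01 {a b : Grassmann K} (ha : a ∈ E0 K) (hb : b ∈ E1 K) : a * b ∈ E1 K := by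
  have h := CliffordAlgebra.evenOdd_mul_le (0 : QuadraticForm K (ℕ →₀ K)) 0 1
    (Submodule.mul_mem_mul ha hb)
  simpa [E1] using h

variable {K} in
theorem mul_mem_10 {a b : Grassmann K} (ha : a ∈ E1 K) (hb : b ∈ E0 K) : a * b ∈ E1 K := by
  have h := CliffordAlgebra.evenOdd_mul_le (0 : QuadraticForm K (ℕ →₀ K)) 1 0
    (Submodule.mul_mem_mul ha hb)
  simpa [E1] using h

variable {K} in
theorem mul_mem_11 {a b : Grassmann K} (ha : a ∈ E1 K) (hb : b ∈ E1 K) : a * b ∈ E0 K := by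
  have h := CliffordAlgebra.evenOdd_mul_le (0 : QuadraticForm K (ℕ →₀ K)) 1 1
    (Submodule.mul_mem_mul ha hb)
  have h2 : (1 + 1 : ZMod 2) = 0 := by decide
  rw [h2] at h
  exact h

theorem algebraMap_mem_E0 (r : K) : algebraMap K (Grassmann K) r ∈ E0 K :=
  CliffordAlgebra.one_le_evenOdd_zero (0 : QuadraticForm K (ℕ →₀ K))
    (Submodule.algebraMap_mem r)

/-- The algebra `M_{1,1}(E)` of the `2 × 2` matrices with diagonal entries in `E_0` and
off-diagonal entries in `E_1`. -/
def M11 : Subalgebra K (Matrix (Fin 2) (Fin 2) (Grassmann K)) where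
  carrier := {M | M 0 0 ∈ E0 K ∧ M 0 1 ∈ E1 K ∧ M 1 0 ∈ E1 K ∧ M 1 1 ∈ E0 K}
  mul_mem' := by
    rintro M N ⟨h1, h2, h3, h4⟩ ⟨k1, k2, k3, k4⟩
    simp only [Set.mem_ofPred_eq, Matrix.mul_apply, Fin.sum_univ_two]
    exact ⟨add_mem (mul_mem_00 h1 k1) (mul_mem_11 h2 k3),
      add_mem (mul_mem_01 h1 k2) (mul_mem_10 h2 k4),
      add_mem (mul_mem_10 h3 k1) (mul_mem_01 h4 k3),
      add_mem (mul_mem_11 h3 k2) (mul_mem_00 h4 k4)⟩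
  add_mem' := by
    rintro M N ⟨h1, h2, h3, h4⟩ ⟨k1, k2, k3, k4⟩
    exact ⟨add_mem h1 k1, add_mem h2 k2, add_mem h3 k3, add_mem h4 k4⟩
  algebraMap_mem' := by
    intro r
    simp only [Set.mem_ofPred_eq, Matrix.algebraMap_matrix_apply]
    simp [algebraMap_mem_E0]

variable {K} in
/-- The involution `(a, b; c, d)^* = (d, b; -c, a)` on `M_{1,1}(E)`. -/
def inv11 (M : M11 K) : M11 K :=
  ⟨!![M.1 1 1, M.1 0 1; -M.1 1 0, M.1 0 0],
    by
      obtain ⟨h1, h2, h3, h4⟩ := M.2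
      exact ⟨h4, h2, (E1 K).neg_mem h3, h1⟩⟩

variable {K} in
/-- Evaluation of `*`-polynomials at `x_i = a_i`, `x_i^* = a_i^*`. -/
def evalAt (a : ℕ → M11 K) : StarPoly K →ₐ[K] M11 K :=
  FreeAlgebra.lift K (Sum.elim a (fun i => inv11 (a i)))

/-- `T_*(R)`: the `*`-identities of `R = M_{1,1}(E)`. -/
def identities : Submodule K (StarPoly K) where
  carrier := {f | ∀ a : ℕ → M11 K, evalAt a f = 0}
  add_mem' hf hg a := by rw [map_add, hf a, hg a, add_zero]
  zero_mem' a := map_zero _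
  smul_mem' r f hf a := by rw [map_smul, hf a, smul_zero]

/-- `C(R, *)`: the `*`-central polynomials of `R = M_{1,1}(E)`. -/
def centralPolys : Submodule K (StarPoly K) where
  carrier := {f | ∀ a : ℕ → M11 K, evalAt a f ∈ Subalgebra.center K (M11 K)}
  add_mem' hf hg a := by rw [map_add]; exact add_mem (hf a) (hg a)
  zero_mem' a := by rw [map_zero]; exact zero_mem _
  smul_mem' r f hf a := by rw [map_smul]; exact Subalgebra.smul_mem _ (hf a) r

end Algebra

/-! ### The polynomials `G_n`, `P_i`, `C_l` and the `*`-spaces `V` and `W` -/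

section Spaces

variable (K : Type*) [Field K]

/-- `G_n = (z_1 ∘ z_2)(z_3 ∘ z_4) ⋯ (z_{2n-1} ∘ z_{2n})`. -/
def G (n : ℕ) : StarPoly K :=
  ((List.range n).map fun i => jordan (z K (2 * i + 1)) (z K (2 * i + 2))).prod

/-- For `l ≥ 1`: `P_1 = [y_2, z_1, z_2][y_3, z_3] ⋯ [y_{l+1}, z_{l+1}]`, and for `1 < i ≤ l + 1`
`P_i = [y_2, z_i, z_1][y_3, z_2] ⋯ [y_i, z_{i-1}][y_{i+1}, z_{i+1}] ⋯ [y_{l+1}, z_{l+1}]`.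
The list `List.range' 3 (l - 1)` is `3, 4, …, l + 1`. -/
def P (l i : ℕ) : StarPoly K :=
  (if i = 1 then ⁅⁅y K 2, z K 1⁆, z K 2⁆ else ⁅⁅y K 2, z K i⁆, z K 1⁆) *
    ((List.range' 3 (l - 1)).map fun j => ⁅y K j, z K (if j ≤ i then j - 1 else j)⁆).prod

/-- `C_l = ∑_{i=1}^{l+1} (-1)^i P_i`, for `l ≥ 1`. -/
def C (l : ℕ) : StarPoly K := ∑ i ∈ Finset.Icc 1 (l + 1), (-1 : StarPoly K) ^ i * P K l i

/-- `V`: the `*`-space generated by `T_*(R)`, by `z_1 ∘ z_2`, by the central polynomial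
`[y_1, z_1, z_2] - 2(z_1 z_2 + z_2 z_1) y_1 = [y_1, z_1, z_2] - 4(z_1 ∘ z_2) y_1`, and by `y_1^p`
if `char K = p > 2`. -/
def V : Submodule K (StarPoly K) :=
  starSpan ((identities K : Set (StarPoly K)) ∪
    {jordan (z K 1) (z K 2),
      ⁅⁅y K 1, z K 1⁆, z K 2⁆ - (4 : K) • (jordan (z K 1) (z K 2) * y K 1)} ∪
    {f | 2 < ringChar K ∧ f = y K 1 ^ ringChar K})

/-- `W`: the `*`-space generated by all `G_n`, `C_l` and `C_l G_n` with `n, l ≥ 1`. -/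
def W : Submodule K (StarPoly K) :=
  starSpan ({f | ∃ n, 0 < n ∧ f = G K n} ∪ {f | ∃ l, 0 < l ∧ f = C K l} ∪
    {f | ∃ l n, 0 < l ∧ 0 < n ∧ f = C K l * G K n})

end Spaces

end StarM11

end

/-!
Write the value of `y_i` on `R` as `(α_i, β_i; 0, α_i)` and the value of `z_i` as
`(a_i, 0; γ_i, -a_i)`, with `α_i`, `a_i` even, hence central, and `β_i`, `γ_i` odd. Let `∂` be the
Koszul differential, the signed derivation with `∂γ_i = a_i` that treats `a_i` and `β_i` as
constants. A matrix `(p, 2q; 0, p)` is symmetric and a matrix `(s, 0; r, -s)` is skew; the first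
observation, `proper_mem_valueSpan`, is that every value of a `*`-proper polynomial is a sum of
symmetric matrices with `(p, q) = (f, ∂f)`, of skew matrices with `(r, s) = (f, ∂f)`, and of skew
matrices with `(r, s) = (a_m ∂(γ_i γ_j), 0)`, where `f` runs through monomials `a_m γ_I β_J` with
restrictions on their lengths.

Hence for a central `*`-proper polynomial the skew part of the value vanishes, and its symmetric
part is `(p, 0; 0, p)` with `∂p = 0`; here the infinite dimension enters, as no nonzero element of
the Grassmann algebra is annihilated by all generators. Exactness of the Koszul complex then makes
`p`, up to a constant, a combination of boundaries `a_m ∂γ_I β_J` (`central_value`). The entries are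
functions of the values given to the variables, not independent generators,
  so exactness is proved by hand, by
induction on the number of variables `z_n` (`decompose`, `mem_cyc_of_lt`); that `a_n` may be
cancelled is where `K` has to be infinite (`eq_zero_of_aE_mul`).

Conversely all these boundaries are realized (`cyc_realization`). In `W`, a product of an even
number of `a_i` is the value of an instance of some `G_n`, and a boundary with a factor `β` is the
value of an instance of some `C_l`, because `C_l` itself evaluates to a multiple of
`∂(γ_1 ⋯ γ_{l+1}) β_2 ⋯ β_{l+1}` (`map_C`) and because replacing `y_2` by `[y_2, z, z', …]`
multiplies `β_2` by the corresponding `a`s. In `V`, the first are instances of `z_1 ∘ z_2`, and the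
second are instances of `[y, z, z'] - [y, z', z]`, which is obtained from the third generator of `V`
by antisymmetrization (`exists_V_even`, `exists_V_cyc`). The remaining constant is the value at the
zero point, that is, the constant term of the polynomial; in characteristic `p > 2` the constants
lie in `V` because `y_1 ↦ 1` is an admissible substitution in `y_1^p`.
-/

noncomputable section

set_option linter.unusedSectionVars false
set_option linter.unnecessarySeqFocus false

namespace StarM11

open Submodule

/-! ### Koszul pairs and their matrices -/

section Koszul

variable {K Z A : Type*} [Field K] [CommRing Z] [Ring A] [Algebra K Z] [Algebra K A] [Algebra Z A]
  [IsScalarTower K Z A]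

/-- The ordered product `f i₁ * f i₂ * ⋯` along the list `[i₁, i₂, …]`. -/
def listProd {B : Type*} [Monoid B] (f : ℕ → B) (l : List ℕ) : B := (l.map f).prod

@[simp] theorem listProd_nil {B : Type*} [Monoid B] (f : ℕ → B) : listProd f [] = 1 := rfl

@[simp] theorem listProd_cons {B : Type*} [Monoid B] (f : ℕ → B) (i : ℕ) (l : List ℕ) :
    listProd f (i :: l) = f i * listProd f l := by simp [listProd]

theorem listProd_append {B : Type*} [Monoid B] (f : ℕ → B) (l l' : List ℕ) :
    listProd f (l ++ l') = listProd f l * listProd f l' := by simp [listProd]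

/-- The Koszul boundary: the value on the monomial `γ_{i₁} γ_{i₂} ⋯` of the signed derivation that
sends each odd `γ_i` to the even `a_i`. It is defined on lists of indices rather than on products,
so that no relation between the `γ_i` has to be respected. -/
def koszul (a : ℕ → Z) (g : ℕ → A) : List ℕ → A
  | [] => 0
  | i :: l => a i • listProd g l - g i * koszul a g l

@[simp] theorem koszul_nil (a : ℕ → Z) (g : ℕ → A) : koszul a g [] = 0 := rfl

@[simp] theorem koszul_cons (a : ℕ → Z) (g : ℕ → A) (i : ℕ) (l : List ℕ) :
    koszul a g (i :: l) = a i • listProd g l - g i * koszul a g l := rfl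

theorem koszul_append (a : ℕ → Z) (g : ℕ → A) (l l' : List ℕ) :
    koszul a g (l ++ l') = koszul a g l * listProd g l' + (-1 : Z) ^ l.length •
      (listProd g l * koszul a g l') := by
  induction l with
  | nil => simp
  | cons i l ih =>
    simp only [List.cons_append, koszul_cons, ih, listProd_append, listProd_cons, List.length_cons,
      pow_succ,
      mul_add, sub_mul, smul_mul_assoc, mul_smul_comm, mul_assoc]
    module

/-- Multiplying a boundary by `γ_{l₀}`, and by `∂γ_{l₀}` in the second component, gives a
combination of pairs `(a_i γ_{l'}, a_i ∂γ_{l'})`: since `∂² = 0`, the second component is the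
boundary `∂(γ_{l₀} ∂γ_l)`. The only identity needed is the product rule for `γ_{l₀} γ_i`. -/
theorem koszul_expand (a : ℕ → Z) (g : ℕ → A) (l₀ l : List ℕ) :
    (listProd g l₀ * koszul a g l, koszul a g l₀ * koszul a g l) ∈
      span K {x : A × A | ∃ i ∈ l, ∃ l',
      (∀ k ∈ l', k ∈ l₀ ∨ k ∈ l) ∧ l'.length + 1 = l₀.length + l.length ∧
        x = (a i • listProd g l', a i • koszul a g l')} := by
  induction l generalizing l₀ with
  | nil => simp
  | cons i l ih =>
    have e : (listProd g l₀ * koszul a g (i :: l), koszul a g l₀ * koszul a g (i :: l)) =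
        (a i • listProd g (l₀ ++ l), a i • koszul a g (l₀ ++ l)) -
        (listProd g (l₀ ++ [i]) * koszul a g l, koszul a g (l₀ ++ [i]) * koszul a g l) := by
      simp only [koszul_append, listProd_append, listProd_cons, koszul_cons, listProd_nil,
        koszul_nil, Prod.mk_sub_mk,
        Prod.mk.injEq, mul_one, mul_zero, sub_zero]
      constructor
      · simp only [mul_sub, mul_smul_comm, mul_assoc]
      · simp only [mul_sub, add_mul, mul_smul_comm, smul_mul_assoc, mul_assoc, one_mul]
        module
    rw [e]
    refine sub_mem (subset_span ⟨i, by simp, l₀ ++ l, by simp; tauto, by simp; omega, rfl⟩) ?_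
    refine span_mono ?_ (ih (l₀ ++ [i]))
    rintro _ ⟨j, hj, l', h1, h2, rfl⟩
    refine ⟨j, by simp [hj], l', fun k hk => ?_, by simp at h2 ⊢; omega, rfl⟩
    have := h1 k hk
    simp at this ⊢
    tauto

/-- The monomial `a_m γ_I β_J` together with its Koszul boundary `a_m ∂γ_I β_J`, for lists of
indices `m`, `I`, `J`. -/
def kPair (a : ℕ → Z) (g b : ℕ → A) (m I J : List ℕ) : A × A :=
  (listProd a m • (listProd g I * listProd b J), listProd a m • (koszul a g I * listProd b J))

theorem koszul_expand_mem (a : ℕ → Z) (g b : ℕ → A) (m I₀ I J : List ℕ) :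
    (listProd a m • (listProd g I₀ * koszul a g I * listProd b J),
      listProd a m • (koszul a g I₀ * koszul a g I * listProd b J)) ∈
      span K {x : A × A | ∃ i ∈ I, ∃ I', (∀ k ∈ I', k ∈ I₀ ∨ k ∈ I) ∧
        I'.length + 1 = I₀.length + I.length ∧ x = kPair a g b (i :: m) I' J} := by
  let φ : A × A →ₗ[K] A × A :=
    { toFun := fun x => (listProd a m • (x.1 * listProd b J), listProd a m • (x.2 * listProd b J))
      map_add' := fun x y => by simp [add_mul]
      map_smul' := fun c x => by
        simp only [Prod.smul_fst, Prod.smul_snd, smul_mul_assoc, RingHom.id_apply, Prod.smul_mk,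
          smul_comm c (listProd a m)] }
  have h := Submodule.mem_map_of_mem (f := φ) (koszul_expand (K := K) a g I₀ I)
  rw [Submodule.map_span] at h
  refine span_mono ?_ h
  rintro _ ⟨_, ⟨i, hi, I', h1, h2, rfl⟩, rfl⟩
  refine ⟨i, hi, I', h1, h2, ?_⟩
  simp only [φ, kPair, listProd_cons, LinearMap.coe_mk, AddHom.coe_mk, smul_mul_assoc, smul_smul,
    mul_comm (listProd a m)]

variable (K A) in
/-- The matrix `(p, 2q; 0, p)`. When `q` is odd and `p` is even this is the general form of a
`*`-symmetric element of `M_{1,1}(E)`. -/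
def symMat : A × A →ₗ[K] Matrix (Fin 2) (Fin 2) A where
  toFun x := !![x.1, x.2 + x.2; 0, x.1]
  map_add' x y := by
    ext i j; fin_cases i <;> fin_cases j <;> simp [add_add_add_comm]
  map_smul' c x := by ext i j; fin_cases i <;> fin_cases j <;> simp

variable (K A) in
/-- The matrix `(s, 0; r, -s)` of the pair `(r, s)`. When `r` is odd and `s` is even this is the
general form of a `*`-skew element of `M_{1,1}(E)`. -/
def skewMat : A × A →ₗ[K] Matrix (Fin 2) (Fin 2) A where
  toFun x := !![x.2, 0; x.1, -x.2]
  map_add' x y := by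
    ext i j; fin_cases i <;> fin_cases j <;> simp [add_comm]
  map_smul' c x := by ext i j; fin_cases i <;> fin_cases j <;> simp

theorem skewMat_mul_symMat (c : A) (α : Z) (x : A × A) :
    skewMat K A (c, α • 1) * symMat K A x =
      symMat K A (c * x.2, α • x.2) + skewMat K A (c * x.1, α • x.1 - c * x.2) := by
  ext i j
  fin_cases i <;> fin_cases j <;> simp [skewMat, symMat, Matrix.mul_apply, Fin.sum_univ_two,
    mul_add] <;>
    abel

theorem skewMat_mul_skewMat (c : A) (α : Z) (x : A × A) :
    skewMat K A (c, α • 1) * skewMat K A x =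
      symMat K A (α • x.2, 0) + skewMat K A (c * x.2 - α • x.1, 0) := by
  ext i j
  fin_cases i <;> fin_cases j <;> simp [skewMat, symMat, Matrix.mul_apply, Fin.sum_univ_two] <;>
    abel

theorem symMat_mul_symMat (x y : A × A) :
    symMat K A x * symMat K A y = symMat K A (x.1 * y.1, x.1 * y.2 + x.2 * y.1) := by
  ext i j
  fin_cases i <;> fin_cases j <;>
    simp [symMat, Matrix.mul_apply, Fin.sum_univ_two, mul_add, add_mul] <;> abel

theorem symMat_mul_skewMat (x y : A × A) :
    symMat K A x * skewMat K A y =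
      symMat K A (x.2 * y.1, -(x.2 * y.2)) + skewMat K A (x.1 * y.1, x.1 * y.2 + x.2 * y.1) := by
  ext i j
  fin_cases i <;> fin_cases j <;>
    simp [skewMat, symMat, Matrix.mul_apply, Fin.sum_univ_two, add_mul] <;> abel

/-- The elements `g_i` and `b_i` behave like odd elements: they anticommute, and the `g_i` square
to zero. -/
structure IsSuper (g b : ℕ → A) : Prop where
  gg : ∀ i j, g i * g j = -(g j * g i)
  gsq : ∀ i, g i * g i = 0
  bg : ∀ i j, b i * g j = -(g j * b i)
  bb : ∀ i j, b i * b j = -(b j * b i)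

theorem IsSuper.b_mul {g b : ℕ → A} (h : IsSuper g b) (a : ℕ → Z) (j : ℕ) (I : List ℕ) :
    b j * listProd g I = (-1 : Z) ^ I.length • (listProd g I * b j) ∧
      b j * koszul a g I = -((-1 : Z) ^ I.length • (koszul a g I * b j)) := by
  induction I with
  | nil => simp
  | cons i I ih =>
    obtain ⟨h1, h2⟩ := ih
    constructor
    · rw [listProd_cons, ← mul_assoc, h.bg, neg_mul, mul_assoc, h1]
      simp only [List.length_cons, pow_succ, mul_smul_comm, mul_assoc]
      module
    · rw [koszul_cons, mul_sub, mul_smul_comm, h1, ← mul_assoc, h.bg, neg_mul, mul_assoc, h2]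
      simp only [List.length_cons, pow_succ, mul_smul_comm, mul_assoc, mul_neg, sub_mul,
        smul_mul_assoc]
      module

theorem IsSuper.koszul_b {g b : ℕ → A} (h : IsSuper g b) (a : ℕ → Z) (j : ℕ) (I : List ℕ) :
    ∃ ε : Z, (ε = 1 ∨ ε = -1) ∧ b j * listProd g I = ε • (listProd g I * b j) ∧
      b j * koszul a g I = -(ε • (koszul a g I * b j)) :=
  ⟨_, neg_one_pow_eq_or Z I.length, h.b_mul a j I⟩

/-- The Koszul pairs occurring in symmetric values of `*`-proper polynomials: as many `γ`s as
`β`s, and an even number of factors `a_k` if there are no `β`s. -/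
def symSet (a : ℕ → Z) (g b : ℕ → A) : Set (A × A) :=
  {x | ∃ m I J : List ℕ, I.length = J.length ∧ (J = [] → Even m.length) ∧ x = kPair a g b m I J}

/-- The pairs occurring in skew values of `*`-proper polynomials: Koszul pairs with one more `γ`
than `β`s, having an even number of factors `a_k` if there are no `β`s, and the pairs
`(a_m (a_i γ_j - a_j γ_i), 0)`, for which `m` has arbitrary length. -/
def skewSet (a : ℕ → Z) (g b : ℕ → A) : Set (A × A) :=
  {x | ∃ m I J : List ℕ, I.length = J.length + 1 ∧ (J = [] → Even m.length) ∧
    x = kPair a g b m I J} ∪ {x | ∃ m i j, x = (listProd a m • (a i • g j - a j • g i), 0)}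

variable (K) in
/-- The space that contains all values of `*`-proper polynomials: the sum of the symmetric
matrices of `symSet` and of the skew matrices of `skewSet`. -/
def valueSpan (a : ℕ → Z) (g b : ℕ → A) : Submodule K (Matrix (Fin 2) (Fin 2) A) :=
  (span K (symSet a g b)).map (symMat K A) ⊔ (span K (skewSet a g b)).map (skewMat K A)

theorem symMat_mem_valueSpan {a : ℕ → Z} {g b : ℕ → A} {x : A × A} (h : x ∈ span K (symSet a g b)) :
    symMat K A x ∈ valueSpan K a g b := mem_sup_left (mem_map_of_mem h)

theorem skewMat_mem_valueSpan {a : ℕ → Z} {g b : ℕ → A} {x : A × A}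
    (h : x ∈ span K (skewSet a g b)) :
    skewMat K A x ∈ valueSpan K a g b := mem_sup_right (mem_map_of_mem h)

theorem valueSpan_mul_mem {a : ℕ → Z} {g b : ℕ → A} (T : Matrix (Fin 2) (Fin 2) A)
    (h1 : ∀ x ∈ symSet a g b, T * symMat K A x ∈ valueSpan K a g b)
    (h2 : ∀ x ∈ skewSet a g b, T * skewMat K A x ∈ valueSpan K a g b) :
    ∀ x ∈ valueSpan K a g b, T * x ∈ valueSpan K a g b := by
  have key : valueSpan K a g b ≤ (valueSpan K a g b).comap (LinearMap.mulLeft K T) := by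
    refine sup_le ?_ ?_
    · rw [map_span, span_le]
      rintro _ ⟨x, hx, rfl⟩
      exact h1 x hx
    · rw [map_span, span_le]
      rintro _ ⟨x, hx, rfl⟩
      exact h2 x hx
  exact fun x hx => key hx

/-- The symmetric part of a product with `skewMat (γ_k, a_k)` lies in the span of `symSet`; used
with `I₀ = [k]` for symmetric right factors and with `I₀ = []` for skew ones. -/
theorem prepend_mem {a : ℕ → Z} {g b : ℕ → A} (m J : List ℕ) (I₀ I : List ℕ)
    (hl : I₀.length + I.length = J.length + 1) (hJ : J = [] → Odd m.length) :
    (listProd a m • (listProd g I₀ * koszul a g I * listProd b J),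
      listProd a m • (koszul a g I₀ * koszul a g I * listProd b J)) ∈
      span K (symSet a g b) := by
  refine span_mono ?_ (koszul_expand_mem a g b m I₀ I J)
  rintro _ ⟨i, _, I', _, h2, rfl⟩
  exact ⟨i :: m, I', J, by omega, fun h => by simpa using (hJ h).add_one, rfl⟩

/-- Left multiplication by the value of `z_k` preserves `valueSpan`. -/
theorem z_mul_mem {a : ℕ → Z} {g b : ℕ → A} (k : ℕ) :
    ∀ x ∈ valueSpan K a g b, skewMat K A (g k, a k • 1) * x ∈ valueSpan K a g b := by
  refine valueSpan_mul_mem _ ?_ ?_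
  · rintro _ ⟨m, I, J, hl, hJ, rfl⟩
    rw [skewMat_mul_symMat]
    refine add_mem (symMat_mem_valueSpan ?_) (skewMat_mem_valueSpan ?_)
    · by_cases hJ0 : J = []
      · have : I = [] := by simpa [hJ0] using hl
        simp only [kPair, this, koszul_nil, zero_mul, smul_zero, mul_zero]
        exact zero_mem _
      · have := prepend_mem (K := K) (a := a) (g := g) (b := b) m J [k] I (by simp; omega)
          (fun h => absurd h hJ0)
        simpa [kPair, mul_assoc, smul_smul, mul_comm] using this
    · refine subset_span (Or.inl ⟨m, k :: I, J, by simp [hl], hJ, ?_⟩)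
      simp only [kPair, listProd_cons, koszul_cons, mul_smul_comm, sub_mul, smul_mul_assoc,
        mul_assoc,
        Prod.mk.injEq, true_and]
      module
  · rintro _ (⟨m, I, J, hl, hJ, rfl⟩ | ⟨m, i, j, rfl⟩)
    · rw [skewMat_mul_skewMat]
      refine add_mem (symMat_mem_valueSpan ?_) (skewMat_mem_valueSpan ?_)
      · have := prepend_mem (K := K) (a := a) (g := g) (b := b) (k :: m) J [] I (by simp; omega)
          (fun h => by simpa using (hJ h).add_one)
        simpa [kPair, mul_assoc, smul_smul, mul_comm] using this
      · by_cases hJ0 : J = []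
        · obtain ⟨i, rfl⟩ : ∃ i, I = [i] := List.length_eq_one_iff.1 (by simpa [hJ0] using hl)
          -- Without `β`s the combination `∂(γ_k γ_i)` is one of the exceptional pairs, whatever the
          -- parity of `m`.
          refine subset_span (Or.inr ⟨m, i, k, ?_⟩)
          simp only [kPair, hJ0, koszul_cons, koszul_nil, listProd_cons, listProd_nil, mul_one,
            mul_zero, sub_zero,
            mul_smul_comm, Prod.mk.injEq, and_true]
          module
        · have h1 : (listProd a m • (listProd g [k] * koszul a g I * listProd b J),
              listProd a m • (koszul a g [k] * koszul a g I * listProd b J)) ∈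
              span K (skewSet a g b) := by
            refine span_mono ?_ (koszul_expand_mem a g b m [k] I J)
            rintro _ ⟨i, _, I', _, h2, rfl⟩
            exact Or.inl ⟨i :: m, I', J, by simp at h2; omega, fun h => absurd h hJ0, rfl⟩
          have h2 : kPair a g b (k :: m) I J ∈ span K (skewSet a g b) :=
            subset_span (Or.inl ⟨k :: m, I, J, hl, fun h => absurd h hJ0, rfl⟩)
          convert sub_mem h1 h2 using 1
          simp only [kPair, listProd_cons, listProd_nil, koszul_cons, koszul_nil, mul_one, mul_zero,
            sub_zero,
            smul_mul_assoc, mul_smul_comm, one_mul, Prod.mk_sub_mk, Prod.mk.injEq, mul_assoc]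
          constructor <;> module
    · rw [skewMat_mul_skewMat]
      refine add_mem (symMat_mem_valueSpan ?_) (skewMat_mem_valueSpan ?_)
      · rw [smul_zero]
        exact zero_mem _
      · have h1 : (listProd a (k :: m) • (a i • g j - a j • g i), 0) ∈ span K (skewSet a g b) :=
          subset_span (Or.inr ⟨_, _, _, rfl⟩)
        convert neg_mem h1 using 1
        simp [mul_smul]

theorem symMat_mul_skewMat_mem {a : ℕ → Z} {g b : ℕ → A} (h : IsSuper g b) (μ : List ℕ) (i j : ℕ)
    (m I J : List ℕ) (hl : I.length = J.length + 1) :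
    symMat K A (kPair a g b μ [i] [j]) * skewMat K A (kPair a g b m I J) ∈ valueSpan K a g b := by
  obtain ⟨ε, hε, e1, e2⟩ := h.koszul_b a j I
  have hs : ∀ {S : Submodule K (A × A)} {x : A × A}, x ∈ S → ε • x ∈ S := by
    rintro S x hx
    rcases hε with rfl | rfl
    · rwa [one_smul]
    · rw [neg_smul, one_smul]; exact neg_mem hx
  rw [symMat_mul_skewMat]
  refine add_mem (symMat_mem_valueSpan ?_) (skewMat_mem_valueSpan ?_)
  · have : kPair a g b (i :: (μ ++ m)) I (j :: J) ∈ span K (symSet a g b) :=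
      subset_span ⟨_, _, _, by simp [hl], by simp, rfl⟩
    convert hs this using 1
    simp only [kPair, listProd_cons, listProd_nil, koszul_cons, koszul_nil, mul_one, mul_zero,
      sub_zero, listProd_append,
      smul_mul_assoc, mul_smul_comm, one_mul, Prod.smul_mk, Prod.mk.injEq]
    rw [← mul_assoc (b j), ← mul_assoc (b j), e1, e2]
    simp only [smul_mul_assoc, mul_assoc, neg_mul]
    constructor <;> module
  · have : kPair a g b (μ ++ m) (i :: I) (j :: J) ∈ span K (skewSet a g b) :=
      subset_span (Or.inl ⟨_, _, _, by simp [hl], by simp, rfl⟩)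
    convert hs this using 1
    simp only [kPair, listProd_cons, listProd_nil, koszul_cons, koszul_nil, mul_one, mul_zero,
      sub_zero, listProd_append,
      smul_mul_assoc, mul_smul_comm, one_mul, Prod.smul_mk, Prod.mk.injEq, mul_assoc, sub_mul]
    rw [← mul_assoc (b j), ← mul_assoc (b j), e1, e2]
    simp only [smul_mul_assoc, mul_smul_comm, mul_assoc, neg_mul, mul_neg]
    constructor <;> module

theorem symMat_mul_symMat_mem {a : ℕ → Z} {g b : ℕ → A} (h : IsSuper g b) (μ : List ℕ) (i j : ℕ)
    (m I J : List ℕ) (hl : I.length = J.length) :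
    symMat K A (kPair a g b μ [i] [j]) * symMat K A (kPair a g b m I J) ∈ valueSpan K a g b := by
  obtain ⟨ε, hε, e1, e2⟩ := h.koszul_b a j I
  have hs : ∀ {S : Submodule K (A × A)} {x : A × A}, x ∈ S → ε • x ∈ S := by
    rintro S x hx
    rcases hε with rfl | rfl
    · rwa [one_smul]
    · rw [neg_smul, one_smul]; exact neg_mem hx
  rw [symMat_mul_symMat]
  refine symMat_mem_valueSpan ?_
  have : kPair a g b (μ ++ m) (i :: I) (j :: J) ∈ span K (symSet a g b) :=
    subset_span ⟨_, _, _, by simp [hl], by simp, rfl⟩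
  convert hs this using 1
  simp only [kPair, listProd_cons, listProd_nil, koszul_cons, koszul_nil, mul_one, mul_zero,
    sub_zero, listProd_append,
    smul_mul_assoc, mul_smul_comm, one_mul, Prod.smul_mk, Prod.mk.injEq, mul_assoc, sub_mul]
  rw [← mul_assoc (b j), ← mul_assoc (b j), e1, e2]
  simp only [smul_mul_assoc, mul_smul_comm, mul_assoc, neg_mul, mul_neg]
  constructor <;> module

theorem kPair_sub_kPair (a : ℕ → Z) (g b : ℕ → A) (m : List ℕ) (i j : ℕ) :
    kPair a g b (i :: m) [j] [] - kPair a g b (j :: m) [i] [] =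
      (listProd a m • (a i • g j - a j • g i), 0) := by
  simp only [kPair, listProd_cons, listProd_nil, koszul_cons, koszul_nil, mul_one, mul_zero,
    sub_zero,
    Prod.mk_sub_mk, Prod.mk.injEq]
  constructor <;> module

/-- Left multiplication by `symMat (a_μ γ_i β_j, a_μ a_i β_j)`, the typical value of a commutator
that involves some `y_j`, preserves `valueSpan`. -/
theorem y_mul_mem {a : ℕ → Z} {g b : ℕ → A} (h : IsSuper g b) (μ : List ℕ) (i j : ℕ) :
    ∀ x ∈ valueSpan K a g b, symMat K A (kPair a g b μ [i] [j]) * x ∈ valueSpan K a g b := by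
  refine valueSpan_mul_mem _ ?_ ?_
  · rintro _ ⟨m, I, J, hl, hJ, rfl⟩
    exact symMat_mul_symMat_mem h _ _ _ _ _ _ hl
  · rintro _ (⟨m, I, J, hl, hJ, rfl⟩ | ⟨m, i', j', rfl⟩)
    · exact symMat_mul_skewMat_mem h _ _ _ _ _ _ hl
    · rw [← kPair_sub_kPair a g b, map_sub, mul_sub]
      exact sub_mem (symMat_mul_skewMat_mem h _ _ _ _ _ _ (by simp))
        (symMat_mul_skewMat_mem h _ _ _ _ _ _ (by simp))

theorem one_mem_valueSpan {a : ℕ → Z} {g b : ℕ → A} : (1 : Matrix (Fin 2) (Fin 2) A) ∈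
    valueSpan K a g b := by
  have : kPair a g b [] [] [] ∈ span K (symSet a g b) :=
      subset_span ⟨[], [], [], by simp, by simp, rfl⟩
  convert symMat_mem_valueSpan this
  ext i j
  fin_cases i <;> fin_cases j <;> simp [symMat, kPair]

end Koszul

/-! ### Values of `*`-proper polynomials -/

section Values

variable {K Z A : Type*} [Field K] [CommRing Z] [Ring A] [Algebra K Z] [Algebra K A] [Algebra Z A]
  [IsScalarTower K Z A]

/-- The value `(α, β; 0, α)` of a symmetric variable, with `α` central. -/
def yMat (α : Z) (β : A) : Matrix (Fin 2) (Fin 2) A := !![α • 1, β; 0, α • 1]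

theorem yMat_lie_skewMat {β γ : A} (α c : Z) (h : β * γ = -(γ * β)) :
    ⁅yMat α β, skewMat K A (γ, c • 1)⁆ = -symMat K A (γ * β, c • β) := by
  ext i j
  fin_cases i <;> fin_cases j <;>
    simp [Ring.lie_def, yMat, skewMat, symMat, h] <;> module

theorem yMat_lie_yMat {β β' : A} (α α' : Z) : ⁅yMat α β, yMat α' β'⁆ = 0 := by
  ext i j
  fin_cases i <;> fin_cases j <;>
    simp [Ring.lie_def, yMat] <;> module

theorem symMat_lie_yMat {β p q : A} (α : Z) (h : p * β = β * p) : ⁅symMat K A (p, q),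
    yMat α β⁆ = 0 := by
  ext i j
  fin_cases i <;> fin_cases j <;>
    simp [Ring.lie_def, yMat, symMat, h] <;> module

theorem symMat_lie_skewMat {p q γ : A} (c : Z) (h : p * γ = γ * p) (h' : q * γ = -(γ * q)) :
    ⁅symMat K A (p, q), skewMat K A (γ, c • 1)⁆ =
      symMat K A (-(γ * q + γ * q), -(c • (q + q))) := by
  ext i j
  fin_cases i <;> fin_cases j <;>
    simp [Ring.lie_def, skewMat, symMat, h, h', add_mul, mul_add]
      <;> module

theorem skewMat_lie_skewMat {r γ : A} (c c' : Z) :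
    ⁅skewMat K A (r, c • 1), skewMat K A (γ, c' • 1)⁆ =
      skewMat K A (c' • (r + r) - c • (γ + γ), 0) := by
  ext i j
  fin_cases i <;> fin_cases j <;>
    simp [Ring.lie_def, skewMat] <;> module

theorem skewMat_lie_yMat {r β : A} (α : Z) (h : r * β = -(β * r)) :
    ⁅skewMat K A (r, 0), yMat α β⁆ = -symMat K A (β * r, 0) := by
  ext i j
  fin_cases i <;> fin_cases j <;>
    simp [Ring.lie_def, skewMat, symMat, yMat, h]

variable (K) in
/-- The elements `T` with `T * valueSpan ⊆ valueSpan`. They form a subalgebra, whereas `valueSpan`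
is not visibly closed under multiplication. -/
def stab (a : ℕ → Z) (g b : ℕ → A) : Subalgebra K (Matrix (Fin 2) (Fin 2) A) where
  carrier := {T | ∀ x ∈ valueSpan K a g b, T * x ∈ valueSpan K a g b}
  mul_mem' := fun hS hT x hx => by rw [mul_assoc]; exact hS _ (hT _ hx)
  add_mem' := fun hS hT x hx => by rw [add_mul]; exact add_mem (hS _ hx) (hT _ hx)
  algebraMap_mem' := fun r x hx => by
    rw [Algebra.algebraMap_eq_smul_one, smul_mul_assoc, one_mul]; exact Submodule.smul_mem _ _ hx

theorem lie_mem_subalgebra {B : Type*} [Ring B] [Algebra K B] (S : Subalgebra K B) {x y : B}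
    (hx : x ∈ S) (hy : y ∈ S) : ⁅x, y⁆ ∈ S := by
  rw [Ring.lie_def]
  exact sub_mem (mul_mem hx hy) (mul_mem hy hx)

variable (K) in
/-- A space containing the values of all commutators in which some `y_j` occurs. -/
def commSym (a : ℕ → Z) (g b : ℕ → A) : Submodule K (Matrix (Fin 2) (Fin 2) A) :=
  span K {T | ∃ m i j, T = symMat K A (kPair a g b m [i] [j])}

variable (K) in
/-- A space containing the values of all commutators in the `z_i` alone. -/
def commSkew (a : ℕ → Z) (g : ℕ → A) : Submodule K (Matrix (Fin 2) (Fin 2) A) :=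
  span K {T | ∃ m i j, T = skewMat K A (listProd a m • (a i • g j - a j • g i), 0)}

variable (K) in
/-- A space containing the values of all commutators of length at least two in the `y_i` and
`z_i`. That commutators in the `z_i` alone stabilize `valueSpan` is carried along as part of the
induction on the length, because they are commutators of elements that do. -/
def commVal (a : ℕ → Z) (g b : ℕ → A) : Submodule K (Matrix (Fin 2) (Fin 2) A) :=
  commSym K a g b ⊔ (commSkew K a g ⊓ (stab K a g b).toSubmodule)

variable {a : ℕ → Z} {g b : ℕ → A}

theorem commVal_le_stab (h : IsSuper g b) : commVal K a g b ≤ (stab K a g b).toSubmodule := by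
  refine sup_le (span_le.2 ?_) inf_le_right
  rintro _ ⟨m, i, j, rfl⟩
  exact y_mul_mem h m i j

theorem skewMat_mem_stab (k : ℕ) : skewMat K A (g k, a k • 1) ∈ stab K a g b := z_mul_mem k

/-- The linear map `u ↦ ⁅u, v⁆`. -/
def lieRight (v : Matrix (Fin 2) (Fin 2) A) :
    Matrix (Fin 2) (Fin 2) A →ₗ[K] Matrix (Fin 2) (Fin 2) A :=
  LinearMap.mulRight K v - LinearMap.mulLeft K v

theorem lieRight_apply (v u : Matrix (Fin 2) (Fin 2) A) : lieRight (K := K) v u = ⁅u, v⁆ := by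
  simp [lieRight, Ring.lie_def]

theorem symMat_kPair_lie_skewMat (h : IsSuper g b) (m : List ℕ) (i j k : ℕ) :
    ⁅symMat K A (kPair a g b m [i] [j]), skewMat K A (g k, a k • 1)⁆ =
      (-2 : K) • symMat K A (kPair a g b (i :: m) [k] [j]) := by
  rw [kPair, symMat_lie_skewMat, ← map_smul]
  · congr 1
    simp only [kPair, listProd_cons, listProd_nil, koszul_cons, koszul_nil, mul_one, mul_zero,
      sub_zero, neg_smul, two_smul,
      smul_mul_assoc, mul_smul_comm, one_mul, Prod.mk.injEq, Prod.mk_add_mk,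
      Prod.neg_mk]
    constructor <;> module
  · simp only [listProd_cons, listProd_nil, mul_one, smul_mul_assoc, mul_smul_comm]
    rw [mul_assoc, h.bg, mul_neg, ← mul_assoc, h.gg, neg_mul, neg_neg, mul_assoc]
  · simp only [listProd_cons, listProd_nil, koszul_cons, koszul_nil, mul_one, mul_zero, sub_zero,
      smul_mul_assoc, mul_smul_comm, one_mul, h.bg]
    simp

theorem commVal_lie_skewMat (h : IsSuper g b) (k : ℕ) {u : Matrix (Fin 2) (Fin 2) A}
    (hu : u ∈ commVal K a g b) : ⁅u, skewMat K A (g k, a k • 1)⁆ ∈ commVal K a g b := by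
  obtain ⟨u₁, h₁, u₂, ⟨h₂, h₃⟩, rfl⟩ := mem_sup.1 hu
  rw [← lieRight_apply (K := K), map_add, lieRight_apply, lieRight_apply]
  refine add_mem (mem_sup_left ?_) (mem_sup_right ⟨?_, ?_⟩)
  · have key : commSym K a g b ≤ (commSym K a g b).comap
        (lieRight (skewMat K A (g k, a k • 1))) := by
      refine span_le.2 ?_
      rintro _ ⟨m, i, j, rfl⟩
      rw [SetLike.mem_coe, mem_comap, lieRight_apply, symMat_kPair_lie_skewMat h]
      exact Submodule.smul_mem _ _ (subset_span ⟨_, _, _, rfl⟩)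
    rw [← lieRight_apply (K := K)]
    exact key h₁
  · have key : commSkew K a g ≤ (commSkew K a g).comap (lieRight (skewMat K A (g k, a k • 1))) := by
      refine span_le.2 ?_
      rintro _ ⟨m, i, j, rfl⟩
      have hm : skewMat K A (listProd a (k :: m) • (a i • g j - a j • g i), 0) ∈ commSkew K a g :=
        subset_span ⟨_, _, _, rfl⟩
      have := add_mem hm hm
      have e := skewMat_lie_skewMat (K := K) (r := listProd a m • (a i • g j - a j • g i))
          (γ := g k) 0 (a k)
      rw [zero_smul] at e
      rw [SetLike.mem_coe, mem_comap, lieRight_apply, e]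
      rw [← map_add] at this
      convert this using 2
      simp only [listProd_cons, Prod.mk_add_mk, Prod.mk.injEq]
      constructor <;> module
    rw [← lieRight_apply (K := K)]
    exact key h₂
  · exact lie_mem_subalgebra _ h₃ (skewMat_mem_stab k)

/-- A second symmetric variable kills the symmetric part of a commutator, and turns its skew part
into a symmetric one. -/
theorem commVal_lie_yMat (h : IsSuper g b) (k : ℕ) (α : Z) {u : Matrix (Fin 2) (Fin 2) A}
    (hu : u ∈ commVal K a g b) : ⁅u, yMat α (b k)⁆ ∈ commVal K a g b := by
  obtain ⟨u₁, h₁, u₂, ⟨h₂, h₃⟩, rfl⟩ := mem_sup.1 hu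
  rw [← lieRight_apply (K := K), map_add, lieRight_apply, lieRight_apply]
  refine mem_sup_left (add_mem ?_ ?_)
  · have key : commSym K a g b ≤ (commSym K a g b).comap (lieRight (yMat α (b k))) := by
      refine span_le.2 ?_
      rintro _ ⟨m, i, j, rfl⟩
      rw [SetLike.mem_coe, mem_comap, lieRight_apply, kPair, symMat_lie_yMat]
      · exact zero_mem _
      · simp only [listProd_cons, listProd_nil, mul_one, smul_mul_assoc, mul_smul_comm]
        rw [mul_assoc, h.bb, mul_neg, ← mul_assoc, ← mul_assoc, h.bg, neg_mul]
    rw [← lieRight_apply (K := K)]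
    exact key h₁
  · have key : commSkew K a g ≤ (commSym K a g b).comap (lieRight (yMat α (b k))) := by
      refine span_le.2 ?_
      rintro _ ⟨m, i, j, rfl⟩
      have hm : ∀ i j, symMat K A (kPair a g b (i :: m) [j] [k]) ∈ commSym K a g b :=
        fun i j => subset_span ⟨_, _, _, rfl⟩
      have := sub_mem (hm i j) (hm j i)
      rw [SetLike.mem_coe, mem_comap, lieRight_apply, skewMat_lie_yMat]
      · rw [← map_sub] at this
        rw [← map_neg]
        convert this using 2
        simp only [kPair, listProd_cons, listProd_nil, koszul_cons, koszul_nil, mul_one, mul_zero,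
          sub_zero,
          smul_mul_assoc, mul_smul_comm, one_mul, Prod.mk_sub_mk, Prod.neg_mk, Prod.mk.injEq,
          mul_sub, h.bg]
        constructor <;> module
      · simp only [smul_mul_assoc, mul_smul_comm, sub_mul, mul_sub, h.bg]
        module
    rw [← lieRight_apply (K := K)]
    exact key h₂

theorem skewMat_smul_lie_yMat (α : Z) (β : A) (γ : A) (c : Z) (h : β * γ = -(γ * β)) :
    ⁅skewMat K A (γ, c • 1), yMat α β⁆ = symMat K A (γ * β, c • β) := by
  have e := yMat_lie_skewMat (K := K) α c h
  rw [Ring.lie_def] at e ⊢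
  rw [← neg_sub, e, neg_neg]

theorem leftComm_mem_commVal (h : IsSuper g b) {α : ℕ → Z}
    (Ψ : StarPoly K →ₐ[K] Matrix (Fin 2) (Fin 2) A)
    (hy : ∀ i, Ψ (y K i) = yMat (α i) (b i)) (hz : ∀ i, Ψ (z K i) = skewMat K A (g i, a i • 1))
    {u : StarPoly K} (hu : u ∈ yzVars K) (l : List (StarPoly K)) (hl : l ≠ [])
    (hl' : ∀ v ∈ l, v ∈ yzVars K) : Ψ (leftComm u l) ∈ commVal K a g b := by
  have hlie : ∀ u v : StarPoly K, Ψ ⁅u, v⁆ = ⁅Ψ u, Ψ v⁆ := fun u v => by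
    simp [Ring.lie_def]
  have hp : ∀ i j, symMat K A (g i * b j, a i • b j) ∈ commSym K a g b := fun i j =>
    subset_span ⟨[], i, j, by simp [kPair]⟩
  induction l using List.reverseRecOn with
  | nil => exact absurd rfl hl
  | append_singleton l v ih =>
    have hv := hl' v (by simp)
    have e : Ψ (leftComm u (l ++ [v])) = ⁅Ψ (leftComm u l), Ψ v⁆ := by
      simp [leftComm, hlie]
    rw [e]
    by_cases hl0 : l = []
    · subst hl0
      change ⁅Ψ u, Ψ v⁆ ∈ _
      rcases hu with ⟨i, rfl⟩ | ⟨i, rfl⟩ <;> rcases hv with ⟨j, rfl⟩ | ⟨j, rfl⟩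
      · rw [hy, hy, yMat_lie_yMat]
        exact zero_mem _
      · rw [hy, hz, yMat_lie_skewMat _ _ (h.bg _ _)]
        exact mem_sup_left (neg_mem (hp _ _))
      · rw [hy, hz, skewMat_smul_lie_yMat _ _ _ _ (h.bg _ _)]
        exact mem_sup_left (hp _ _)
      · refine mem_sup_right ⟨?_, ?_⟩
        · rw [hz, hz, skewMat_lie_skewMat]
          have hm : skewMat K A (listProd a [] • (a j • g i - a i • g j), 0) ∈ commSkew K a g :=
            subset_span ⟨_, _, _, rfl⟩
          have := add_mem hm hm
          rw [← map_add] at this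
          rw [SetLike.mem_coe]
          convert this using 2
          simp only [listProd_nil, Prod.mk_add_mk, Prod.mk.injEq]
          constructor <;> module
        · rw [hz, hz]
          exact lie_mem_subalgebra _ (skewMat_mem_stab _) (skewMat_mem_stab _)
    · have := ih hl0 (fun v hv => hl' v (by simp [hv]))
      rcases hv with ⟨j, rfl⟩ | ⟨j, rfl⟩
      · rw [hy]; exact commVal_lie_yMat h _ _ this
      · rw [hz]; exact commVal_lie_skewMat h _ this

/-- Values of `*`-proper polynomials lie in `valueSpan`: the generators of `properAlg` take values
in `stab`, and `1` belongs to `valueSpan`. -/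
theorem proper_mem_valueSpan (h : IsSuper g b) {α : ℕ → Z}
    (Ψ : StarPoly K →ₐ[K] Matrix (Fin 2) (Fin 2) A)
    (hy : ∀ i, Ψ (y K i) = yMat (α i) (b i)) (hz : ∀ i, Ψ (z K i) = skewMat K A (g i, a i • 1))
    {w : StarPoly K} (hw : w ∈ properAlg K) : Ψ w ∈ valueSpan K a g b := by
  have key : properAlg K ≤ (stab K a g b).comap Ψ := by
    refine Algebra.adjoin_le ?_
    rintro f (⟨i, rfl⟩ | ⟨u, hu, l, hl, hl', rfl⟩)
    · rw [SetLike.mem_coe, Subalgebra.mem_comap, hz]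
      exact skewMat_mem_stab i
    · exact commVal_le_stab h (leftComm_mem_commVal h Ψ hy hz hu l hl hl')
  have := key hw 1 one_mem_valueSpan
  rwa [mul_one] at this

end Values

/-! ### Parity in the Grassmann algebra and generic evaluation -/

section Points

variable {K : Type*} [Field K]

theorem E0_comm {x : Grassmann K} (hx : x ∈ E0 K) (w : Grassmann K) : x * w = w * x := by
  have hι : ∀ (m : ℕ →₀ K), x * ExteriorAlgebra.ι K m = ExteriorAlgebra.ι K m * x := by
    intro m
    have sw : ∀ m n : ℕ →₀ K, ExteriorAlgebra.ι K m * ExteriorAlgebra.ι K n =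
        -(ExteriorAlgebra.ι K n * ExteriorAlgebra.ι K m) := fun m n =>
      eq_neg_of_add_eq_zero_left (ExteriorAlgebra.ι_add_mul_swap m n)
    induction x, hx using CliffordAlgebra.even_induction with
    | algebraMap r => exact Algebra.commutes _ _
    | add u v _ _ hu hv => rw [add_mul, mul_add, hu, hv]
    | ι_mul_ι_mul m₁ m₂ u _ hu =>
      change ExteriorAlgebra.ι K m₁ * ExteriorAlgebra.ι K m₂ * u * ExteriorAlgebra.ι K m =
        ExteriorAlgebra.ι K m * (ExteriorAlgebra.ι K m₁ * ExteriorAlgebra.ι K m₂ * u)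
      rw [mul_assoc, hu, ← mul_assoc, mul_assoc _ _ (ExteriorAlgebra.ι K m), sw m₂ m, mul_neg,
        ← mul_assoc, sw m₁ m]
      simp only [neg_mul, neg_neg, mul_assoc]
  induction w using ExteriorAlgebra.induction with
  | algebraMap r => exact (Algebra.commutes _ _).symm
  | ι m => exact hι m
  | mul u v hu hv => rw [← mul_assoc, hu, mul_assoc, hv, mul_assoc]
  | add u v hu hv => rw [mul_add, add_mul, hu, hv]

theorem E1_anticomm {x w : Grassmann K} (hx : x ∈ E1 K) (hw : w ∈ E1 K) :
    x * w = -(w * x) := by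
  have hι : ∀ (m : ℕ →₀ K), x * ExteriorAlgebra.ι K m = -(ExteriorAlgebra.ι K m * x) := by
    intro m
    have sw : ∀ m n : ℕ →₀ K, ExteriorAlgebra.ι K m * ExteriorAlgebra.ι K n =
        -(ExteriorAlgebra.ι K n * ExteriorAlgebra.ι K m) := fun m n =>
      eq_neg_of_add_eq_zero_left (ExteriorAlgebra.ι_add_mul_swap m n)
    induction x, hx using CliffordAlgebra.odd_induction with
    | ι n => exact sw n m
    | add u v _ _ hu hv => rw [add_mul, mul_add, hu, hv, neg_add]
    | ι_mul_ι_mul m₁ m₂ u _ hu =>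
      change ExteriorAlgebra.ι K m₁ * ExteriorAlgebra.ι K m₂ * u * ExteriorAlgebra.ι K m =
        -(ExteriorAlgebra.ι K m * (ExteriorAlgebra.ι K m₁ * ExteriorAlgebra.ι K m₂ * u))
      rw [mul_assoc, hu, mul_neg, ← mul_assoc, mul_assoc _ _ (ExteriorAlgebra.ι K m), sw m₂ m,
        mul_neg, ← mul_assoc, sw m₁ m]
      simp only [neg_mul, neg_neg, mul_assoc]
  induction w, hw using CliffordAlgebra.odd_induction with
  | ι n => exact hι n
  | add u v _ _ hu hv => rw [add_mul, mul_add, hu, hv, neg_add]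
  | ι_mul_ι_mul m₁ m₂ u _ hu =>
    change x * (ExteriorAlgebra.ι K m₁ * ExteriorAlgebra.ι K m₂ * u) =
        -(ExteriorAlgebra.ι K m₁ * ExteriorAlgebra.ι K m₂ * u * x)
    rw [← mul_assoc, ← mul_assoc, hι, neg_mul, mul_assoc _ x, hι, mul_neg, neg_neg, mul_assoc,
      mul_assoc, hu]
    simp only [mul_neg, mul_assoc]

theorem E1_sq (h2 : (2 : K) ≠ 0) {x : Grassmann K} (hx : x ∈ E1 K) : x * x = 0 := by
  have h := E1_anticomm hx hx
  have : (2 : K) • (x * x) = 0 := by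
    rw [two_smul]
    nth_rewrite 1 [h]
    simp
  exact (smul_eq_zero.1 this).resolve_left h2

variable (K) in
/-- Functions from the points of the generic evaluation (a value in `M_{1,1}(E)` for each variable
`x_i`) to the Grassmann algebra. Working with functions replaces generic matrices, and makes a
`*`-identity the same thing as a polynomial with zero value. -/
abbrev Fn : Type _ := (ℕ → M11 K) → Grassmann K

variable (K) in
/-- The centre of `Fn K`, a commutative ring of scalars. It is a type of its own, rather
than the subalgebra, so that the action on `Fn K` given below is the only one. -/
def FnCenter : Type _ := Subalgebra.center K (Fn K)

instance : CommRing (FnCenter K) := inferInstanceAs (CommRing (Subalgebra.center K (Fn K)))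

instance : Algebra K (FnCenter K) := inferInstanceAs (Algebra K (Subalgebra.center K (Fn K)))

instance : Algebra (FnCenter K) (Fn K) where
  smul c x := c.1 * x
  algebraMap := (Subalgebra.center K (Fn K)).val.toRingHom
  commutes' c x := (Subalgebra.mem_center_iff.1 c.2 x).symm
  smul_def' _ _ := rfl

instance : IsScalarTower K (FnCenter K) (Fn K) :=
  ⟨fun r c x => smul_mul_assoc r c.1 x⟩

/-- All values of `f` are even. -/
def IsEvenFn (f : Fn K) : Prop := ∀ p, f p ∈ E0 K

/-- All values of `f` are odd. -/
def IsOddFn (f : Fn K) : Prop := ∀ p, f p ∈ E1 K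

/-- An even function, as a central element. -/
def IsEvenFn.toCenter {f : Fn K} (h : IsEvenFn f) : FnCenter K :=
  ⟨f, Subalgebra.mem_center_iff.2 fun w => funext fun p => (E0_comm (h p) (w p)).symm⟩

theorem IsEvenFn.toCenter_smul {f : Fn K} (h : IsEvenFn f) (x : Fn K) :
    h.toCenter • x = f * x := rfl

theorem IsOddFn.anticomm {f f' : Fn K} (h : IsOddFn f) (h' : IsOddFn f') :
    f * f' = -(f' * f) := funext fun p => E1_anticomm (h p) (h' p)

theorem isSuper_of_odd (h2 : (2 : K) ≠ 0) {g b : ℕ → Fn K} (hg : ∀ i, IsOddFn (g i))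
    (hb : ∀ i, IsOddFn (b i)) : IsSuper g b where
  gg i j := (hg i).anticomm (hg j)
  bg i j := (hb i).anticomm (hg j)
  bb i j := (hb i).anticomm (hb j)
  gsq i := funext fun p => E1_sq h2 (hg i p)

variable (K) in
/-- The even entry `a_i` of the value `(a_i, 0; γ_i, -a_i)` of `z_i`, as a function. -/
def aE (i : ℕ) : Fn K := fun p => (2⁻¹ : K) • ((p i).1 0 0 - (p i).1 1 1)

variable (K) in
/-- The diagonal entry `α_i` of the value `(α_i, β_i; 0, α_i)` of `y_i`, as a function. -/
def alE (i : ℕ) : Fn K := fun p => (2⁻¹ : K) • ((p i).1 0 0 + (p i).1 1 1)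

theorem aE_even (i : ℕ) : IsEvenFn (aE K i) := fun p =>
  Submodule.smul_mem _ _ (sub_mem (p i).2.1 (p i).2.2.2.2)

theorem alE_even (i : ℕ) : IsEvenFn (alE K i) := fun p =>
  Submodule.smul_mem _ _ (add_mem (p i).2.1 (p i).2.2.2.2)

variable (K) in
/-- The function `a_i`, as a central element. -/
def aC (i : ℕ) : FnCenter K := (aE_even i).toCenter

variable (K) in
/-- The function `α_i`, as a central element. -/
def alC (i : ℕ) : FnCenter K := (alE_even i).toCenter

variable (K) in
/-- The odd entry `γ_i` of the value of `z_i`, as a function. -/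
def gF (i : ℕ) : Fn K := fun p => (p i).1 1 0

variable (K) in
/-- The odd entry `β_i` of the value of `y_i`, as a function. -/
def bF (i : ℕ) : Fn K := fun p => (p i).1 0 1

theorem gF_odd (i : ℕ) : IsOddFn (gF K i) := fun p => (p i).2.2.2.1

theorem bF_odd (i : ℕ) : IsOddFn (bF K i) := fun p => (p i).2.2.1

theorem isSuper_std (h2 : (2 : K) ≠ 0) : IsSuper (gF K) (bF K) :=
  isSuper_of_odd h2 gF_odd bF_odd

variable (K) in
/-- The generic evaluation: a `*`-polynomial is sent to the matrix whose entries are the entries of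
its values, as functions of the point. -/
def evalMat : StarPoly K →ₐ[K] Matrix (Fin 2) (Fin 2) (Fn K) :=
  FreeAlgebra.lift K (Sum.elim (fun i => Matrix.of fun r s p => (p i).1 r s)
    (fun i => Matrix.of fun r s p => (inv11 (p i)).1 r s))

theorem evalMat_apply (f : StarPoly K) (p : ℕ → M11 K) (r s : Fin 2) :
    evalMat K f r s p = (evalAt p f).1 r s := by
  have h : ((Pi.evalAlgHom K (fun _ : ℕ → M11 K => Grassmann K) p).mapMatrix).comp (evalMat K) =
      (M11 K).val.comp (evalAt p) := by
    refine FreeAlgebra.hom_ext (funext fun x => ?_)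
    rcases x with i | i <;> ext r s <;> simp [evalMat, evalAt]
  exact congrFun (congrFun (DFunLike.congr_fun h f) r) s

theorem evalMat_y (h2 : (2 : K) ≠ 0) (i : ℕ) : evalMat K (y K i) = yMat (alC K i) (bF K i) := by
  ext r s p
  rw [evalMat_apply]
  fin_cases r <;> fin_cases s <;>
    simp [y, evalAt, yMat, inv11, alC, alE, bF, IsEvenFn.toCenter_smul, add_comm, ← two_smul K,
      smul_smul, h2]

theorem evalMat_z (h2 : (2 : K) ≠ 0) (i : ℕ) :
    evalMat K (z K i) = skewMat K (Fn K) (gF K i, aC K i • 1) := by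
  ext r s p
  rw [evalMat_apply]
  fin_cases r <;> fin_cases s <;>
    simp [z, evalAt, skewMat, inv11, aC, aE, gF, IsEvenFn.toCenter_smul, ← two_smul K,
      smul_smul, h2, ← smul_neg]

theorem mem_identities_iff (f : StarPoly K) : f ∈ identities K ↔ evalMat K f = 0 := by
  constructor
  · intro h
    ext r s p
    rw [evalMat_apply, h p]
    rfl
  · intro h p
    apply Subtype.ext
    ext r s
    rw [← evalMat_apply, h]
    rfl

end Points

/-! ### Exactness of the Koszul complex on functions -/

section Exactness

variable {K : Type*} [Field K]

/-- A polynomial with coefficients in a `K`-algebra that vanishes at all scalars is zero if `K` is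
infinite: apply the linear functionals of the algebra to its coefficients. -/
theorem poly_eq_zero [Infinite K] {B : Type*} [Ring B] [Algebra K B] (Q : Polynomial B)
    (h : ∀ t : K, Q.eval (algebraMap K B t) = 0) : Q = 0 := by
  ext i
  rw [Polynomial.coeff_zero]
  refine (Module.forall_dual_apply_eq_zero_iff K _).1 fun φ => ?_
  let R : Polynomial K := ∑ j ∈ Finset.range (Q.natDegree + 1),
    Polynomial.monomial j (φ (Q.coeff j))
  have hR : R = 0 := by
    refine Polynomial.funext fun t => ?_
    have := congrArg φ (h t)
    rw [Polynomial.eval_eq_sum_range, map_zero, map_sum] at this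
    rw [Polynomial.eval_zero, ← this, Polynomial.eval_finsetSum]
    refine Finset.sum_congr rfl fun j _ => ?_
    rw [Polynomial.eval_monomial, ← map_pow, ← Algebra.commutes, ← Algebra.smul_def, map_smul,
      smul_eq_mul, mul_comm]
  by_cases hi : i < Q.natDegree + 1
  · have : R.coeff i = φ (Q.coeff i) := by
      simp only [R, Polynomial.finsetSum_coeff, Polynomial.coeff_monomial]
      rw [Finset.sum_ite_eq' , if_pos (Finset.mem_range.2 hi)]
    rw [← this, hR, Polynomial.coeff_zero]
  · rw [Polynomial.coeff_eq_zero_of_natDegree_lt (by omega), map_zero]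

theorem listProd_apply (f : ℕ → Fn K) (l : List ℕ) (p : ℕ → M11 K) :
    listProd f l p = listProd (fun i => f i p) l := by
  induction l with
  | nil => rfl
  | cons i l ih => rw [listProd_cons, listProd_cons, Pi.mul_apply, ih]

theorem center_smul_apply (c : FnCenter K) (x : Fn K) (p : ℕ → M11 K) :
    (c • x) p = c.1 p * x p := rfl

theorem coe_listProd_aC (l : List ℕ) : (listProd (aC K) l).1 = listProd (aE K) l := by
  induction l with
  | nil => rfl
  | cons i l ih => rw [listProd_cons, listProd_cons, ← ih]; rfl

theorem listProd_congr {B : Type*} [Monoid B] {f f' : ℕ → B} {l : List ℕ}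
    (h : ∀ i ∈ l, f i = f' i) :
    listProd f l = listProd f' l := by
  rw [listProd, listProd, List.map_congr_left h]

theorem koszul_apply_congr {p p' : ℕ → M11 K} {I : List ℕ} (h1 : ∀ i ∈ I, aE K i p = aE K i p')
    (h2 : ∀ i ∈ I, gF K i p = gF K i p') :
    koszul (aC K) (gF K) I p = koszul (aC K) (gF K) I p' := by
  induction I with
  | nil => rfl
  | cons i I ih =>
    have ih' := ih (fun j hj => h1 j (by simp [hj])) (fun j hj => h2 j (by simp [hj]))
    have e : listProd (gF K) I p = listProd (gF K) I p' := by
      rw [listProd_apply, listProd_apply, listProd_congr fun j hj => h2 j (by simp [hj])]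
    change aE K i p * listProd (gF K) I p - gF K i p * koszul (aC K) (gF K) I p =
      aE K i p' * listProd (gF K) I p' - gF K i p' * koszul (aC K) (gF K) I p'
    rw [h1 i (by simp), h2 i (by simp), ih', e]

variable (K) in
/-- The Koszul pair of the functions `a_i`, `γ_i`, `β_i`. -/
abbrev kPairE (m I J : List ℕ) : Fn K × Fn K := kPair (aC K) (gF K) (bF K) m I J

theorem kPairE_fst (m I J : List ℕ) (p : ℕ → M11 K) :
    (kPairE K m I J).1 p = listProd (aE K) m p * (listProd (gF K) I p * listProd (bF K) J p) := by
  rw [← coe_listProd_aC]; rfl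

theorem kPairE_snd (m I J : List ℕ) (p : ℕ → M11 K) :
    (kPairE K m I J).2 p = listProd (aE K) m p *
      (koszul (aC K) (gF K) I p * listProd (bF K) J p) := by
  rw [← coe_listProd_aC]; rfl

theorem kPairE_congr {p p' : ℕ → M11 K} {m I J : List ℕ} (h0 : ∀ i ∈ m, aE K i p = aE K i p')
    (h1 : ∀ i ∈ I, aE K i p = aE K i p') (h2 : ∀ i ∈ I, gF K i p = gF K i p')
    (h3 : ∀ i, bF K i p = bF K i p') :
    (kPairE K m I J).1 p = (kPairE K m I J).1 p' ∧ (kPairE K m I J).2 p =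
      (kPairE K m I J).2 p' := by
  rw [kPairE_fst, kPairE_fst, kPairE_snd, kPairE_snd, koszul_apply_congr h1 h2]
  simp only [listProd_apply]
  rw [listProd_congr h0, listProd_congr h2, listProd_congr fun j _ => h3 j]
  exact ⟨rfl, rfl⟩

/-- The point obtained from `p` by giving `z_n` the value `(a, 0; c, -a)` and leaving all the `y_i`
and the other `z_i` unchanged. -/
def setZ (p : ℕ → M11 K) (n : ℕ) (a c : Grassmann K) (ha : a ∈ E0 K) (hc : c ∈ E1 K) :
    ℕ → M11 K :=
  Function.update p n ⟨!![alE K n p + a, bF K n p; c, alE K n p - a],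
    add_mem (alE_even n p) ha, bF_odd n p, hc, sub_mem (alE_even n p) ha⟩

section setZ
variable (p : ℕ → M11 K) (n : ℕ) (a c : Grassmann K) (ha : a ∈ E0 K) (hc : c ∈ E1 K)

theorem setZ_bF (i : ℕ) : bF K i (setZ p n a c ha hc) = bF K i p := by
  by_cases h : i = n
  · subst h; simp [bF, setZ]
  · simp [bF, setZ, h]

theorem setZ_gF_self : gF K n (setZ p n a c ha hc) = c := by simp [gF, setZ]

theorem setZ_aE_self (h2 : (2 : K) ≠ 0) : aE K n (setZ p n a c ha hc) = a := by
  simp [aE, setZ, ← two_smul K, smul_smul, h2]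

theorem setZ_gF {i : ℕ} (h : i ≠ n) : gF K i (setZ p n a c ha hc) = gF K i p := by
  simp [gF, setZ, h]

theorem setZ_aE {i : ℕ} (h : i ≠ n) : aE K i (setZ p n a c ha hc) = aE K i p := by
  simp [aE, setZ, h]

end setZ

/-- A coincidence of values at two points passes from a set of pairs to its span. -/
theorem span_congr {S : Set (Fn K × Fn K)} {p p' : ℕ → M11 K}
    (hS : ∀ x ∈ S, x.1 p = x.1 p' ∧ x.2 p = x.2 p') :
    ∀ x ∈ span K S, x.1 p = x.1 p' ∧ x.2 p = x.2 p' := by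
  intro x hx
  induction hx using span_induction with
  | mem x hx => exact hS x hx
  | zero => exact ⟨rfl, rfl⟩
  | add x y _ _ hx hy =>
    constructor
    · change x.1 p + y.1 p = x.1 p' + y.1 p'; rw [hx.1, hy.1]
    · change x.2 p + y.2 p = x.2 p' + y.2 p'; rw [hx.2, hy.2]
  | smul c x _ hx =>
    constructor
    · change c • x.1 p = c • x.1 p'; rw [hx.1]
    · change c • x.2 p = c • x.2 p'; rw [hx.2]

/-- Along the line `t ↦ a_n + t` the first component of a combination of Koszul pairs is a
polynomial in the scalar `t`. -/
theorem exists_poly (h2 : (2 : K) ≠ 0) (p : ℕ → M11 K) (n : ℕ) {S : Set (Fn K × Fn K)}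
    (hS : ∀ x ∈ S, ∃ m I J, x = kPairE K m I J) (x : Fn K × Fn K) (hx : x ∈ span K S) :
    ∃ Q : Polynomial (Grassmann K), ∀ t : K, Q.eval (algebraMap K (Grassmann K) t) =
      x.1 (setZ p n (aE K n p + algebraMap K _ t) (gF K n p)
        (add_mem (aE_even n p) (algebraMap_mem_E0 K t)) (gF_odd n p)) := by
  induction hx using span_induction with
  | mem x hx =>
    obtain ⟨m, I, J, rfl⟩ := hS x hx
    have hg : ∀ t : K, listProd (gF K) I (setZ p n (aE K n p + algebraMap K _ t) (gF K n p)
        (add_mem (aE_even n p) (algebraMap_mem_E0 K t)) (gF_odd n p)) = listProd (gF K) I p := by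
      intro t
      rw [listProd_apply, listProd_apply]
      refine listProd_congr fun i _ => ?_
      by_cases h : i = n
      · rw [h, setZ_gF_self]
      · rw [setZ_gF _ _ _ _ _ _ h]
    have hb : ∀ t : K, listProd (bF K) J (setZ p n (aE K n p + algebraMap K _ t) (gF K n p)
        (add_mem (aE_even n p) (algebraMap_mem_E0 K t)) (gF_odd n p)) = listProd (bF K) J p := by
      intro t
      rw [listProd_apply, listProd_apply]
      exact listProd_congr fun i _ => setZ_bF _ _ _ _ _ _ _
    have key : ∃ Q : Polynomial (Grassmann K), ∀ t : K, Q.eval (algebraMap K (Grassmann K) t) =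
        listProd (aE K) m (setZ p n (aE K n p + algebraMap K _ t) (gF K n p)
        (add_mem (aE_even n p) (algebraMap_mem_E0 K t)) (gF_odd n p)) *
          (listProd (gF K) I p * listProd (bF K) J p) := by
      clear hx
      induction m with
      | nil => exact ⟨Polynomial.C (listProd (gF K) I p * listProd (bF K) J p), fun t => by simp⟩
      | cons i m ih =>
        obtain ⟨Q, hQ⟩ := ih
        by_cases h : i = n
        · subst h
          refine ⟨Q * Polynomial.X + Polynomial.C (aE K i p) * Q, fun t => ?_⟩
          rw [Polynomial.eval_add, Polynomial.eval_mul_X, Polynomial.eval_C_mul, hQ, listProd_cons,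
            Pi.mul_apply, setZ_aE_self _ _ _ _ _ _ h2, ← Algebra.commutes, add_mul, add_mul,
            mul_assoc, mul_assoc, add_comm]
        · refine ⟨Polynomial.C (aE K i p) * Q, fun t => ?_⟩
          rw [Polynomial.eval_C_mul, hQ, listProd_cons, Pi.mul_apply, setZ_aE _ _ _ _ _ _ h,
            mul_assoc]
    obtain ⟨Q, hQ⟩ := key
    exact ⟨Q, fun t => by rw [hQ, kPairE_fst, hg, hb]⟩
  | zero => exact ⟨0, fun t => by simp⟩
  | add x y _ _ hx hy =>
    obtain ⟨Q, hQ⟩ := hx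
    obtain ⟨Q', hQ'⟩ := hy
    exact ⟨Q + Q', fun t => by rw [Polynomial.eval_add, hQ, hQ']; rfl⟩
  | smul c x _ hx =>
    obtain ⟨Q, hQ⟩ := hx
    exact ⟨c • Q, fun t => by rw [Polynomial.eval_smul, hQ]; rfl⟩

/-- The function `a_n` is not a zero divisor for combinations of Koszul pairs, although its values
may be nilpotent: on the line `a_n + t` the product is a polynomial divisible by the monic
`X + a_n`. -/
theorem eq_zero_of_aE_mul [Infinite K] (h2 : (2 : K) ≠ 0) (n : ℕ) {S : Set (Fn K × Fn K)}
    (hS : ∀ x ∈ S, ∃ m I J, x = kPairE K m I J) (x : Fn K × Fn K) (hx : x ∈ span K S)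
    (h : ∀ p, aE K n p * x.1 p = 0) : x.1 = 0 := by
  funext p
  obtain ⟨Q, hQ⟩ := exists_poly h2 p n hS x hx
  have h1 : (Polynomial.X + Polynomial.C (aE K n p)) * Q = 0 := by
    refine poly_eq_zero (K := K) _ fun t => ?_
    have := h (setZ p n (aE K n p + algebraMap K _ t) (gF K n p)
        (add_mem (aE_even n p) (algebraMap_mem_E0 K t)) (gF_odd n p))
    rw [← hQ, setZ_aE_self _ _ _ _ _ _ h2] at this
    rw [add_mul, Polynomial.X_mul, Polynomial.eval_add, Polynomial.eval_mul_X,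
      Polynomial.eval_C_mul, ← this, add_mul, Algebra.commutes, add_comm]
  have h3 : Q = 0 := by
    rwa [(Polynomial.monic_X_add_C _).mul_right_eq_zero_iff] at h1
  -- At `t = 0` the polynomial recovers the value at `p` itself.
  have h4 := hQ 0
  rw [h3, Polynomial.eval_zero] at h4
  refine Eq.trans ?_ h4.symm
  refine congrArg x.1 (funext fun i => Subtype.ext (Matrix.ext fun r s => ?_))
  have half : ∀ x : Grassmann K, x = (2⁻¹ : K) • x + (2⁻¹ : K) • x := fun x => by
    rw [← two_smul K, smul_smul, mul_inv_cancel₀ h2, one_smul]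
  by_cases hi : i = n
  · subst hi
    fin_cases r <;> fin_cases s <;> simp [setZ, aE, alE, bF, gF, smul_add, smul_sub]
    · exact half _
    · exact half _
  · simp [setZ, hi]

variable (K) in
/-- The span of `1` and of the boundaries `a_m ∂γ_I β_J` with one more `γ` than `β`s, where the
number of factors `a_k` in `a_m` is odd if there are no `β`s. It turns out to contain every value
of a central `*`-proper polynomial. -/
def cyc : Submodule K (Fn K) :=
  span K ({f | ∃ m I J : List ℕ, I.length = J.length + 1 ∧ (J = [] → Odd m.length) ∧
    f = listProd (aC K) m • (koszul (aC K) (gF K) I * listProd (bF K) J)} ∪ {1})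

/-- The pairs of `symSet` that involve only `z_k` with `k < n`. -/
def symLt (K : Type*) [Field K] (n : ℕ) : Set (Fn K × Fn K) :=
  {x | ∃ m I J : List ℕ, (∀ k ∈ m, k < n) ∧ (∀ k ∈ I, k < n) ∧ I.length = J.length ∧
    (J = [] → Even m.length) ∧ x = kPairE K m I J}

/-- The Koszul pairs that involve `a_k` only for `k ≤ n` and `γ_k` only for `k < n`, without
condition on their lengths. -/
def restLt (K : Type*) [Field K] (n : ℕ) : Set (Fn K × Fn K) :=
  {x | ∃ m I J : List ℕ, (∀ k ∈ m, k < n + 1) ∧ (∀ k ∈ I, k < n) ∧ x = kPairE K m I J}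

section erase
variable {Z A : Type*} [CommRing Z] [Ring A] [Algebra Z A]

/-- Up to sign, an occurrence of `n` may be moved to the front of a monomial and of its boundary. -/
theorem IsSuper.listProd_erase {g b : ℕ → A} (h : IsSuper g b) (a : ℕ → Z) {n : ℕ} {I : List ℕ}
    (hn : n ∈ I) : ∃ ε : Z, (ε = 1 ∨ ε = -1) ∧ listProd g I = ε • listProd g (n :: I.erase n) ∧
      koszul a g I = ε • koszul a g (n :: I.erase n) := by
  induction I with
  | nil => simp at hn
  | cons i I ih =>
    by_cases hi : i = n
    · subst hi
      exact ⟨1, Or.inl rfl, by simp, by simp⟩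
    · obtain ⟨ε, hε, e1, e2⟩ := ih (by simpa [Ne.symm hi] using hn)
      refine ⟨-ε, by rcases hε with rfl | rfl <;> simp, ?_, ?_⟩
      · rw [listProd_cons, e1, List.erase_cons_tail (by simpa using hi)]
        simp only [listProd_cons, mul_smul_comm]
        rw [← mul_assoc, h.gg i n, neg_mul, mul_assoc]
        module
      · rw [koszul_cons, e1, e2, List.erase_cons_tail (by simpa using hi)]
        simp only [listProd_cons, koszul_cons, mul_smul_comm, mul_sub]
        rw [← mul_assoc (g i), h.gg i n, neg_mul, mul_assoc]
        module

/-- A monomial with a repeated `γ_n` vanishes, and so does its boundary. -/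
theorem IsSuper.cons_cons {g b : ℕ → A} (h : IsSuper g b) (a : ℕ → Z) {n : ℕ} {I : List ℕ}
    (hn : n ∈ I) : listProd g (n :: I) = 0 ∧ koszul a g (n :: I) = 0 := by
  obtain ⟨ε, hε, e1, e2⟩ := h.listProd_erase a hn
  have hz : ∀ x, g n * (g n * x) = 0 := fun x => by rw [← mul_assoc, h.gsq, zero_mul]
  constructor
  · rw [listProd_cons, e1, listProd_cons, mul_smul_comm, hz, smul_zero]
  · rw [koszul_cons, e1, e2]
    simp only [listProd_cons, koszul_cons, mul_smul_comm, mul_sub, hz]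
    module

theorem listProd_erase_comm (a : ℕ → Z) {n : ℕ} {m : List ℕ} (hn : n ∈ m) :
    listProd a m = a n * listProd a (m.erase n) := by
  rw [← listProd_cons]
  exact ((List.perm_cons_erase hn).map a).prod_eq

theorem kPair_of_erase {a : ℕ → Z} {g b : ℕ → A} {n : ℕ} {ε : Z} {I I' : List ℕ} (m J : List ℕ)
    (e1 : listProd g I = ε • listProd g (n :: I')) (e2 : koszul a g I = ε • koszul a g (n :: I')) :
    kPair a g b m I J = (g n * (ε • kPair a g b m I' J).1,
      a n • (ε • kPair a g b m I' J).1 - g n * (ε • kPair a g b m I' J).2) := by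
  rw [kPair, e1, e2, kPair]
  refine Prod.ext ?_ ?_
  · simp only [listProd_cons, smul_mul_assoc, mul_smul_comm, Prod.smul_mk, mul_assoc]
    module
  · simp only [koszul_cons, smul_mul_assoc, mul_smul_comm, Prod.smul_mk, mul_assoc, sub_mul]
    module

/-- For a monomial divisible by `a_n`, the rule `a_n γ_I = ∂(γ_n γ_I) + γ_n ∂γ_I` separates off an
element of `cyc`. -/
theorem kPair_eq_koszul_cons {a : ℕ → Z} {g b : ℕ → A} {n : ℕ} {m m' : List ℕ} (I J : List ℕ)
    (e : listProd a m = a n * listProd a m') :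
    kPair a g b m I J = (listProd a m' • (koszul a g (n :: I) * listProd b J), 0) +
      (g n * (listProd a m' • (koszul a g I * listProd b J)),
        a n • (listProd a m' • (koszul a g I * listProd b J)) - g n * 0) := by
  rw [kPair, e]
  refine Prod.ext ?_ ?_
  · simp only [koszul_cons, smul_mul_assoc, mul_smul_comm, mul_assoc, Prod.fst_add, sub_mul]
    module
  · simp only [Prod.snd_add, mul_zero]
    module

end erase

/-- The step of the induction on the number of `z`-variables: modulo boundaries, a combination of
symmetric pairs is the sum of a part without `z_n` and of `γ_n` times a pair without `γ_n`. -/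
theorem decompose (h2 : (2 : K) ≠ 0) (n : ℕ) (x : Fn K × Fn K) (hx : x ∈ span K (symLt K (n + 1))) :
    ∃ x₀ ∈ span K (symLt K n), ∃ c ∈ cyc K, ∃ r ∈ span K (restLt K n),
      x = x₀ + (c, 0) + (gF K n * r.1, aC K n • r.1 - gF K n * r.2) := by
  induction hx using span_induction with
  | zero => exact ⟨0, zero_mem _, 0, zero_mem _, 0, zero_mem _, by ext <;> simp⟩
  | add x y _ _ hx hy =>
    obtain ⟨x₀, h1, c, h3, r, h4, rfl⟩ := hx
    obtain ⟨x₀', h1', c', h3', r', h4', rfl⟩ := hy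
    refine ⟨_, add_mem h1 h1', _, add_mem h3 h3', _, add_mem h4 h4', ?_⟩
    refine Prod.ext ?_ ?_
    · simp only [Prod.fst_add, mul_add]; abel
    · simp only [Prod.snd_add, Prod.fst_add, mul_add, smul_add]; abel
  | smul k x _ hx =>
    obtain ⟨x₀, h1, c, h3, r, h4, rfl⟩ := hx
    refine ⟨_, Submodule.smul_mem _ k h1, _, Submodule.smul_mem _ k h3, _,
      Submodule.smul_mem _ k h4, ?_⟩
    refine Prod.ext ?_ ?_
    · simp only [Prod.fst_add, Prod.smul_fst, smul_add, mul_smul_comm]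
    · simp only [Prod.snd_add, Prod.smul_snd, Prod.smul_fst, smul_add, mul_smul_comm, smul_sub,
        smul_zero]
      rw [smul_comm k (aC K n)]
  | mem x hx =>
    obtain ⟨m, I, J, hm, hI, hl, hJ, rfl⟩ := hx
    by_cases hnI : n ∈ I
    · obtain ⟨ε, hε, e1, e2⟩ := (isSuper_std h2).listProd_erase (aC K) hnI
      by_cases hnI' : n ∈ I.erase n
      · obtain ⟨e3, e4⟩ := (isSuper_std h2).cons_cons (aC K) hnI'
        refine ⟨0, zero_mem _, 0, zero_mem _, 0, zero_mem _, ?_⟩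
        rw [kPairE, kPair, e1, e2, e3, e4]
        ext <;> simp
      · have hr : kPairE K m (I.erase n) J ∈ span K (restLt K n) := by
          refine subset_span ⟨m, _, J, hm, fun k hk => ?_, rfl⟩
          have h1 := hI k (List.mem_of_mem_erase hk)
          have h3 : k ≠ n := fun h => hnI' (h ▸ hk)
          omega
        refine ⟨0, zero_mem _, 0, zero_mem _, ε • kPairE K m (I.erase n) J, ?_, ?_⟩
        · rcases hε with rfl | rfl
          · rwa [one_smul]
          · rw [neg_smul, one_smul]; exact neg_mem hr
        · rw [zero_add, ← Prod.zero_eq_mk, zero_add]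
          exact kPair_of_erase m J e1 e2
    · have hI' : ∀ k ∈ I, k < n := fun k hk => by
        have h1 := hI k hk
        have h3 : k ≠ n := fun h => hnI (h ▸ hk)
        omega
      by_cases hnm : n ∈ m
      · have e := listProd_erase_comm (aC K) hnm
        -- Here `n` occurs among the `a`s only; if there are no `β`s, removing
        -- `a_n` from an even number of factors leaves an odd number, as `cyc` requires.
        refine ⟨0, zero_mem _, listProd (aC K) (m.erase n) •
          (koszul (aC K) (gF K) (n :: I) * listProd (bF K) J),
          subset_span (Or.inl ⟨_, _, _, by simp [hl], fun h => ?_, rfl⟩),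
          (listProd (aC K) (m.erase n) • (koszul (aC K) (gF K) I * listProd (bF K) J), 0), ?_, ?_⟩
        · have h1 := List.length_erase_add_one hnm
          have h3 := hJ h
          rw [← h1] at h3
          simpa [Nat.even_add_one] using h3
        · have := koszul_expand_mem (K := K) (aC K) (gF K) (bF K) (m.erase n) [] I J
          simp only [listProd_nil, one_mul, koszul_nil, zero_mul, smul_zero] at this
          refine span_mono ?_ this
          rintro _ ⟨i, hi, I', h1, -, rfl⟩
          refine ⟨_, _, _, ?_, fun k hk => ?_, rfl⟩
          · intro k hk
            rcases List.mem_cons.1 hk with rfl | hk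
            · exact hI _ hi
            · exact hm k (List.mem_of_mem_erase hk)
          · have := h1 k hk
            exact hI' k (by simpa using this)
        · rw [zero_add]
          exact kPair_eq_koszul_cons I J e
      · refine ⟨_, subset_span ⟨m, I, J, fun k hk => ?_, hI', hl, hJ, rfl⟩, 0, zero_mem _, 0,
          zero_mem _, by ext <;> simp⟩
        have h1 := hm k hk
        have h3 : k ≠ n := fun h => hnm (h ▸ hk)
        omega

/-- Koszul exactness for functions: a combination of symmetric pairs with zero boundary belongs to
`cyc`. In the decomposition of `decompose`, putting `a_n = γ_n = 0` shows that the part without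
`z_n` has zero boundary; putting only `γ_n = 0` then gives `a_n r.1 = 0`, so that `r.1 = 0`. -/
theorem mem_cyc_of_lt [Infinite K] (h2 : (2 : K) ≠ 0) (n : ℕ) (x : Fn K × Fn K)
    (hx : x ∈ span K (symLt K n)) (h0 : x.2 = 0) : x.1 ∈ cyc K := by
  induction n generalizing x with
  | zero =>
    clear h0
    induction hx using span_induction with
    | zero => exact zero_mem _
    | add x y _ _ hx hy => exact add_mem hx hy
    | smul k x _ hx => exact Submodule.smul_mem _ _ hx
    | mem x hx =>
      obtain ⟨m, I, J, hm, hI, hl, hJ, rfl⟩ := hx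
      have hm' : m = [] := List.eq_nil_iff_forall_not_mem.2 fun k hk => by simpa using hm k hk
      have hI' : I = [] := List.eq_nil_iff_forall_not_mem.2 fun k hk => by simpa using hI k hk
      subst hm' hI'
      have hJ' : J = [] := by simpa using hl.symm
      subst hJ'
      exact subset_span (Or.inr (by simp [kPair]))
  | succ n ih =>
    obtain ⟨x₀, hx₀, c, hc, r, hr, rfl⟩ := decompose h2 n x hx
    have e0 : ∀ p, x₀.2 p + (aE K n p * r.1 p - gF K n p * r.2 p) = 0 := fun p => by
      have h3 : (x₀.2 + 0 + (aC K n • r.1 - gF K n * r.2)) p = 0 := congrFun h0 p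
      rw [add_zero] at h3
      exact h3
    have h1 : x₀.2 = 0 := by
      funext p
      -- Put `z_n = 0`.
      have := e0 (setZ p n 0 0 (zero_mem _) (zero_mem _))
      rw [setZ_aE_self _ _ _ _ _ _ h2, setZ_gF_self, zero_mul, zero_mul, sub_zero, add_zero] at this
      rw [Pi.zero_apply, ← this]
      refine (span_congr ?_ x₀ hx₀).2
      rintro _ ⟨m, I, J, hm, hI, -, -, rfl⟩
      refine kPairE_congr (fun i hi => ?_) (fun i hi => ?_) (fun i hi => ?_) fun i => ?_
      · rw [setZ_aE _ _ _ _ _ _ (hm i hi).ne]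
      · rw [setZ_aE _ _ _ _ _ _ (hI i hi).ne]
      · rw [setZ_gF _ _ _ _ _ _ (hI i hi).ne]
      · rw [setZ_bF]
    have h3 : r.1 = 0 := by
      refine eq_zero_of_aE_mul h2 n (fun x hx => ?_) r hr fun p => ?_
      · obtain ⟨m, I, J, -, -, rfl⟩ := hx
        exact ⟨m, I, J, rfl⟩
      -- Put `γ_n = 0` and keep `a_n`.
      · have := e0 (setZ p n (aE K n p) 0 (aE_even n p) (zero_mem _))
        rw [setZ_aE_self _ _ _ _ _ _ h2, setZ_gF_self, zero_mul, sub_zero, h1, Pi.zero_apply,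
          zero_add] at this
        rw [← this]
        congr 1
        refine (span_congr ?_ r hr).1
        rintro _ ⟨m, I, J, hm, hI, rfl⟩
        refine kPairE_congr (fun i hi => ?_) (fun i hi => ?_) (fun i hi => ?_) fun i => ?_
        · by_cases h : i = n
          · rw [h, setZ_aE_self _ _ _ _ _ _ h2]
          · rw [setZ_aE _ _ _ _ _ _ h]
        · rw [setZ_aE _ _ _ _ _ _ (hI i hi).ne]
        · rw [setZ_gF _ _ _ _ _ _ (hI i hi).ne]
        · rw [setZ_bF]
    have h4 := ih x₀ hx₀ h1
    simpa [h3] using add_mem h4 hc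

theorem mem_cyc [Infinite K] (h2 : (2 : K) ≠ 0) (x : Fn K × Fn K)
    (hx : x ∈ span K (symSet (aC K) (gF K) (bF K))) (h0 : x.2 = 0) : x.1 ∈ cyc K := by
  have mono : ∀ {n n'}, n ≤ n' → symLt K n ⊆ symLt K n' := by
    rintro n n' h _ ⟨m, I, J, hm, hI, hl, hJ, rfl⟩
    exact ⟨m, I, J, fun k hk => (hm k hk).trans_le h, fun k hk => (hI k hk).trans_le h, hl, hJ, rfl⟩
  have : ∃ n, x ∈ span K (symLt K n) := by
    clear h0
    induction hx using span_induction with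
    | zero => exact ⟨0, zero_mem _⟩
    | add x y _ _ hx hy =>
      obtain ⟨n, hn⟩ := hx
      obtain ⟨n', hn'⟩ := hy
      exact ⟨max n n', add_mem (span_mono (mono (le_max_left _ _)) hn)
        (span_mono (mono (le_max_right _ _)) hn')⟩
    | smul k x _ hx =>
      obtain ⟨n, hn⟩ := hx
      exact ⟨n, Submodule.smul_mem _ _ hn⟩
    | mem x hx =>
      obtain ⟨m, I, J, hl, hJ, rfl⟩ := hx
      refine ⟨(m ++ I).sum + 1, subset_span ⟨m, I, J, fun k hk => ?_, fun k hk => ?_, hl, hJ, rfl⟩⟩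
      · exact Nat.lt_succ_of_le (List.le_sum_of_mem (by simp [hk]))
      · exact Nat.lt_succ_of_le (List.le_sum_of_mem (by simp [hk]))
  obtain ⟨n, hn⟩ := this
  exact mem_cyc_of_lt h2 n x hn h0

end Exactness

/-! ### Values of central `*`-proper polynomials -/

section Central

variable {K : Type*} [Field K]

variable (K) in
/-- Contraction of the Grassmann algebra with the `n`-th coordinate functional. -/
def contract (n : ℕ) : Grassmann K →ₗ[K] Grassmann K :=
  CliffordAlgebra.contractLeft (Q := (0 : QuadraticForm K (ℕ →₀ K))) (Finsupp.lapply n)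

theorem contract_ι_mul (n : ℕ) (v : ℕ →₀ K) (x : Grassmann K) :
    contract K n (ExteriorAlgebra.ι K v * x) = v n • x - ExteriorAlgebra.ι K v * contract K n x :=
  CliffordAlgebra.contractLeft_ι_mul _ _ _

/-- An element of the Grassmann algebra involves only finitely many basis vectors. -/
theorem finite_contract_ne_zero (x : Grassmann K) : {n | contract K n x ≠ 0}.Finite := by
  induction x using CliffordAlgebra.left_induction with
  | algebraMap r =>
    convert Set.finite_empty
    ext n
    simp only [Set.mem_ofPred_eq, Set.mem_empty_iff_false, iff_false, not_not]
    exact CliffordAlgebra.contractLeft_algebraMap _ _ r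
  | add x y hx hy =>
    refine (hx.union hy).subset fun n hn => ?_
    by_contra h
    simp only [Set.mem_union, Set.mem_ofPred_eq, not_or, not_not] at h hn
    exact hn (by rw [map_add, h.1, h.2, add_zero])
  | ι_mul x v hx =>
    refine (hx.union v.hasFiniteSupport).subset fun n hn => ?_
    by_contra h
    simp only [Set.mem_union, Set.mem_ofPred_eq, not_or, not_not, Function.mem_support] at h hn
    refine hn ((contract_ι_mul n v x).trans ?_)
    rw [h.1, h.2, zero_smul, mul_zero, sub_zero]

/-- No nonzero element is annihilated by all basis vectors; this is where the infinite dimension of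
the underlying vector space enters. -/
theorem eq_zero_of_ι_mul {x : Grassmann K}
    (h : ∀ n, ExteriorAlgebra.ι K (Finsupp.single n 1) * x = 0) : x = 0 := by
  obtain ⟨n, hn⟩ := (finite_contract_ne_zero x).exists_notMem
  rw [Set.mem_ofPred_eq, not_not] at hn
  have := contract_ι_mul n (Finsupp.single n 1) x
  rw [h n, hn, map_zero, mul_zero, sub_zero, Finsupp.single_eq_same, one_smul] at this
  exact this.symm

theorem ι_mem_E1 (v : ℕ →₀ K) : ExteriorAlgebra.ι K v ∈ E1 K :=
  CliffordAlgebra.ι_mem_evenOdd_one _ v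

/-- Central elements of `M_{1,1}(E)` are scalar matrices. -/
theorem central_entries (h2 : (2 : K) ≠ 0) {M : M11 K} (hM : M ∈ Subalgebra.center K (M11 K)) :
    M.1 0 1 = 0 ∧ M.1 1 0 = 0 ∧ M.1 0 0 = M.1 1 1 := by
  rw [Subalgebra.mem_center_iff] at hM
  have key : ∀ N : M11 K, N.1 * M.1 = M.1 * N.1 := fun N => congrArg Subtype.val (hM N)
  have two : ∀ x : Grassmann K, -x = x → x = 0 := fun x hx => by
    have : (2 : K) • x = 0 := by rw [two_smul]; nth_rewrite 1 [← hx]; simp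
    exact (smul_eq_zero.1 this).resolve_left h2
  have hone : (1 : Grassmann K) ∈ E0 K := by simpa using algebraMap_mem_E0 K 1
  -- Commuting with `diag(1, -1)` kills the off-diagonal entries, and commuting
  -- with `(0, e_n; 0, 0)` identifies the diagonal ones up to annihilators of all `e_n`.
  have h1 := key ⟨!![1, 0; 0, -1], hone, zero_mem _, zero_mem _, neg_mem hone⟩
  refine ⟨?_, ?_, ?_⟩
  · have := congrFun (congrFun h1 0) 1
    simp [Matrix.mul_apply, Fin.sum_univ_two] at this
    exact two _ this.symm
  · have := congrFun (congrFun h1 1) 0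
    simp [Matrix.mul_apply, Fin.sum_univ_two] at this
    exact two _ this
  · rw [← sub_eq_zero]
    refine eq_zero_of_ι_mul fun n => ?_
    have := congrFun (congrFun (key ⟨!![0, ExteriorAlgebra.ι K (Finsupp.single n 1); 0, 0],
      zero_mem _, ι_mem_E1 _, zero_mem _, zero_mem _⟩) 0) 1
    simp [Matrix.mul_apply, Fin.sum_univ_two] at this
    rw [mul_sub, this, ← E0_comm M.2.1, sub_self]

/-- The value of a central `*`-proper polynomial is `(c, 0; 0, c)` with `c ∈ cyc`:
centrality kills the skew part and the boundary of the symmetric part. -/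
theorem central_value [Infinite K] (h2 : (2 : K) ≠ 0) {w : StarPoly K} (hw : w ∈ properAlg K)
    (hc : w ∈ centralPolys K) : ∃ c ∈ cyc K, evalMat K w = symMat K (Fn K) (c, 0) := by
  have h := proper_mem_valueSpan (isSuper_std h2) (evalMat K) (evalMat_y h2) (evalMat_z h2) hw
  obtain ⟨_, ⟨x, hx, rfl⟩, _, ⟨u, -, rfl⟩, he⟩ := mem_sup.1 h
  have hp : ∀ p, x.2 p = 0 ∧ u.1 p = 0 ∧ u.2 p = 0 := by
    intro p
    have two : ∀ v : Grassmann K, v + v = 0 → v = 0 := fun v hv =>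
      (smul_eq_zero.1 (show (2 : K) • v = 0 by rw [two_smul, hv])).resolve_left h2
    obtain ⟨h1, h3, h4⟩ := central_entries h2 (hc p)
    simp only [← evalMat_apply, ← he] at h1 h3 h4
    simp [symMat, skewMat] at h1 h3 h4
    exact ⟨two _ h1, h3, two _ (by nth_rewrite 1 [h4]; exact neg_add_cancel _)⟩
  have e1 : x.2 = 0 := funext fun p => (hp p).1
  have e2 : u = 0 := Prod.ext (funext fun p => (hp p).2.1) (funext fun p => (hp p).2.2)
  refine ⟨x.1, mem_cyc h2 x hx e1, ?_⟩
  rw [← he, e2, map_zero, add_zero, ← e1]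

end Central

/-! ### Substitutions commuting with the involution -/

section Substitution

variable {K : Type*} [Field K]

theorem canInv_mul (f g : StarPoly K) : canInv (f * g) = canInv g * canInv f := by
  simp [canInv]

theorem canInv_add (f g : StarPoly K) : canInv (f + g) = canInv f + canInv g := by
  simp [canInv]

theorem canInv_algebraMap (r : K) :
    canInv (algebraMap K (StarPoly K) r) = algebraMap K (StarPoly K) r := by
  rw [canInv, AlgHom.commutes]
  exact FreeAlgebra.star_algebraMap r

theorem canInv_smul (r : K) (f : StarPoly K) : canInv (r • f) = r • canInv f := by
  rw [Algebra.smul_def, canInv_mul, canInv_algebraMap, ← Algebra.commutes, ← Algebra.smul_def]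

theorem canInv_neg (f : StarPoly K) : canInv (-f) = -canInv f := by
  rw [← neg_one_smul K, canInv_smul, neg_one_smul]

theorem canInv_sub (f g : StarPoly K) : canInv (f - g) = canInv f - canInv g := by
  rw [sub_eq_add_neg, canInv_add, canInv_neg, sub_eq_add_neg]

theorem canInv_inl (i : ℕ) :
    canInv (FreeAlgebra.ι K (Sum.inl i)) = FreeAlgebra.ι K (Sum.inr i) := by
  simp [canInv, swapHom]

theorem canInv_inr (i : ℕ) :
    canInv (FreeAlgebra.ι K (Sum.inr i)) = FreeAlgebra.ι K (Sum.inl i) := by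
  simp [canInv, swapHom]

theorem canInv_canInv (f : StarPoly K) : canInv (canInv f) = f := by
  induction f using FreeAlgebra.induction with
  | grade0 r => rw [canInv_algebraMap, canInv_algebraMap]
  | grade1 x => rcases x with i | i <;> simp [canInv_inl, canInv_inr]
  | mul f g hf hg => rw [canInv_mul, canInv_mul, hf, hg]
  | add f g hf hg => rw [canInv_add, canInv_add, hf, hg]

theorem canInv_y (i : ℕ) : canInv (y K i) = y K i := by
  rw [y, canInv_smul, canInv_add, canInv_inl, canInv_inr, add_comm]

theorem canInv_z (i : ℕ) : canInv (z K i) = -z K i := by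
  rw [z, canInv_smul, canInv_sub, canInv_inl, canInv_inr, ← smul_neg, neg_sub]

theorem canInv_lie (f g : StarPoly K) : canInv ⁅f, g⁆ = ⁅canInv g, canInv f⁆ := by
  rw [Ring.lie_def, canInv_sub, canInv_mul, canInv_mul, Ring.lie_def]

/-- The skew part `(f - f^*) / 2` of a `*`-polynomial. -/
def skewPart (f : StarPoly K) : StarPoly K := (2⁻¹ : K) • (f - canInv f)

theorem canInv_skewPart (f : StarPoly K) : canInv (skewPart f) = -skewPart f := by
  rw [skewPart, canInv_smul, canInv_sub, canInv_canInv, ← smul_neg, neg_sub]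

theorem canInv_leftComm (j : ℕ) (m : List ℕ) :
    canInv (leftComm (y K j) (m.map (z K))) = leftComm (y K j) (m.map (z K)) := by
  induction m using List.reverseRecOn with
  | nil => exact canInv_y j
  | append_singleton m k ih =>
    have e : leftComm (y K j) ((m ++ [k]).map (z K)) =
        ⁅leftComm (y K j) (m.map (z K)), z K k⁆ := by simp [leftComm]
    rw [e, canInv_lie, ih, canInv_z]
    simp only [Ring.lie_def, neg_mul, mul_neg]
    abel

/-- The substitution `y_i ↦ s_i`, `z_i ↦ u_i`, that is `x_i ↦ s_i + u_i`, `x_i^* ↦ s_i - u_i`. -/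
def subst (s u : ℕ → StarPoly K) : StarPoly K →ₐ[K] StarPoly K :=
  FreeAlgebra.lift K (Sum.elim (fun i => s i + u i) (fun i => s i - u i))

theorem subst_canInv {s u : ℕ → StarPoly K} (hs : ∀ i, canInv (s i) = s i)
    (hu : ∀ i, canInv (u i) = -u i) (f : StarPoly K) :
    subst s u (canInv f) = canInv (subst s u f) := by
  induction f using FreeAlgebra.induction with
  | grade0 r => rw [canInv_algebraMap, AlgHom.commutes, canInv_algebraMap]
  | grade1 x =>
    rcases x with i | i <;>
      simp [canInv_inl, canInv_inr, subst, canInv_add, canInv_neg, hs, hu, sub_eq_add_neg]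
  | mul f g hf hg => rw [canInv_mul, map_mul, map_mul, canInv_mul, hf, hg]
  | add f g hf hg => rw [canInv_add, map_add, map_add, canInv_add, hf, hg]

theorem subst_y (h2 : (2 : K) ≠ 0) (s u : ℕ → StarPoly K) (i : ℕ) : subst s u (y K i) = s i := by
  have e : s i + u i + (s i - u i) = (2 : K) • s i := by rw [two_smul]; abel
  simp only [subst, y, map_smul, map_add, FreeAlgebra.lift_ι_apply, Sum.elim_inl, Sum.elim_inr]
  rw [e, smul_smul, inv_mul_cancel₀ h2, one_smul]

theorem subst_z (h2 : (2 : K) ≠ 0) (s u : ℕ → StarPoly K) (i : ℕ) : subst s u (z K i) = u i := by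
  have e : s i + u i - (s i - u i) = (2 : K) • u i := by rw [two_smul]; abel
  simp only [subst, z, map_smul, map_sub, FreeAlgebra.lift_ι_apply, Sum.elim_inl, Sum.elim_inr]
  rw [e, smul_smul, inv_mul_cancel₀ h2, one_smul]

theorem starSpan_map {S : Set (StarPoly K)} {φ : StarPoly K →ₐ[K] StarPoly K}
    (hφ : ∀ f, φ (canInv f) = canInv (φ f)) {f : StarPoly K} (hf : f ∈ starSpan S) :
    φ f ∈ starSpan S := by
  rw [starSpan, mem_sInf] at hf ⊢
  exact fun U hU => hU.1 φ hφ f (hf U hU)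

theorem subset_starSpan {S : Set (StarPoly K)} {f : StarPoly K} (hf : f ∈ S) : f ∈ starSpan S := by
  rw [starSpan, mem_sInf]
  exact fun U hU => hU.2 hf

theorem inv11_mul (M N : M11 K) : inv11 (M * N) = inv11 N * inv11 M := by
  obtain ⟨M, h1, h2, h3, h4⟩ := M
  obtain ⟨N, k1, k2, k3, k4⟩ := N
  apply Subtype.ext
  ext r s
  have e1 := E0_comm h1
  have e4 := E0_comm h4
  have f1 := E0_comm k1
  have f4 := E0_comm k4
  fin_cases r <;> fin_cases s <;> simp [inv11, Matrix.mul_apply, Fin.sum_univ_two]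
  · rw [E1_anticomm h3 k2, e4, add_comm]
  · rw [e1, f4, add_comm]
  · rw [e4, f1]
  · rw [e1, E1_anticomm h2 k3, add_comm]

theorem inv11_add (M N : M11 K) : inv11 (M + N) = inv11 M + inv11 N := by
  obtain ⟨M, h1, h2, h3, h4⟩ := M
  obtain ⟨N, k1, k2, k3, k4⟩ := N
  apply Subtype.ext
  ext r s
  fin_cases r <;> fin_cases s <;> simp [inv11]
  exact add_comm _ _

theorem evalAt_canInv (p : ℕ → M11 K) (f : StarPoly K) :
    evalAt p (canInv f) = inv11 (evalAt p f) := by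
  induction f using FreeAlgebra.induction with
  | grade0 r =>
    rw [canInv_algebraMap, AlgHom.commutes]
    apply Subtype.ext
    ext i j
    fin_cases i <;> fin_cases j <;> simp [inv11, Matrix.algebraMap_matrix_apply]
  | grade1 x =>
    rcases x with i | i
    · simp [canInv_inl, evalAt]
    · rw [canInv_inr]
      apply Subtype.ext
      ext r s
      fin_cases r <;> fin_cases s <;> simp [inv11, evalAt]
  | mul f g hf hg => rw [canInv_mul, map_mul, map_mul, inv11_mul, hf, hg]
  | add f g hf hg => rw [canInv_add, map_add, map_add, inv11_add, hf, hg]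

theorem evalMat_skewPart (h2 : (2 : K) ≠ 0) (f : StarPoly K) : evalMat K (skewPart f) =
    skewMat K (Fn K) (evalMat K f 1 0, (2⁻¹ : K) • (evalMat K f 0 0 - evalMat K f 1 1)) := by
  ext r s p
  rw [skewPart, map_smul, map_sub, Matrix.smul_apply, Matrix.sub_apply, Pi.smul_apply,
    Pi.sub_apply, evalMat_apply, evalMat_apply, evalAt_canInv]
  fin_cases r <;> fin_cases s <;>
    simp [skewMat, inv11, evalMat_apply, ← two_smul K, smul_smul, h2, ← smul_neg]

theorem neg_smul_add_self {Z A : Type*} [CommRing Z] [Ring A] [Algebra K Z] [Algebra K A]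
    [Algebra Z A] [IsScalarTower K Z A] (c P : Z) (κ : K) (x : A) :
    -(c • (κ • P • x + κ • P • x)) = (κ * -2) • (P * c) • x := by
  rw [← two_smul K (κ • P • x), smul_comm c (2 : K), smul_comm c κ, ← mul_smul c P, mul_comm c P,
    smul_smul, ← neg_smul]
  congr 1
  ring

theorem IsOddFn.smul {f : Fn K} (hf : IsOddFn f) (κ : K) (m : List ℕ) :
    IsOddFn (κ • listProd (aC K) m • f) := fun p => by
  refine Submodule.smul_mem _ _ ?_
  rw [center_smul_apply, coe_listProd_aC, listProd_apply]
  refine mul_mem_01 ?_ (hf p)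
  induction m with
  | nil => simpa using algebraMap_mem_E0 K 1
  | cons i m ih => rw [listProd_cons]; exact mul_mem_00 (aE_even i p) ih

/-- Commuting `y_j` with `z`s leaves a symmetric element whose `β` is, up to a nonzero scalar,
`β_j` multiplied by the corresponding `a`s. Substituting it for `y_j` therefore produces arbitrary
  factors `a_m`. -/
theorem evalMat_leftComm (h2 : (2 : K) ≠ 0) (j : ℕ) (m : List ℕ) : ∃ q : Fn K, IsEvenFn q ∧
    evalMat K (leftComm (y K j) (m.map (z K))) =
      symMat K (Fn K) (q, ((-2 : K) ^ m.length * 2⁻¹) • listProd (aC K) m • bF K j) := by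
  induction m using List.reverseRecOn with
  | nil =>
    refine ⟨alE K j, alE_even j, ?_⟩
    change evalMat K (y K j) = _
    rw [evalMat_y h2]
    ext r s
    fin_cases r <;> fin_cases s <;> simp [yMat, symMat, ← two_smul K, smul_smul, h2]
    · rw [alC, IsEvenFn.toCenter_smul, mul_one]
    · rw [alC, IsEvenFn.toCenter_smul, mul_one]
  | append_singleton m k ih =>
    obtain ⟨q, hq, ih⟩ := ih
    have e : leftComm (y K j) ((m ++ [k]).map (z K)) =
        ⁅leftComm (y K j) (m.map (z K)), z K k⁆ := by simp [leftComm]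
    have ho := (bF_odd (K := K) j).smul ((-2 : K) ^ m.length * 2⁻¹) m
    refine ⟨-(gF K k * (((-2 : K) ^ m.length * 2⁻¹) • listProd (aC K) m • bF K j) +
        gF K k * (((-2 : K) ^ m.length * 2⁻¹) • listProd (aC K) m • bF K j)), fun p => ?_, ?_⟩
    · exact neg_mem (add_mem (mul_mem_11 (gF_odd k p) (ho p)) (mul_mem_11 (gF_odd k p) (ho p)))
    · rw [e, Ring.lie_def, map_sub, map_mul, map_mul, ← Ring.lie_def, ih, evalMat_z h2]
      refine (symMat_lie_skewMat (K := K) (aC K k) ?_ ?_).trans ?_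
      rotate_left 2
      · rw [neg_smul_add_self (aC K k) (listProd (aC K) m), listProd_append, List.length_append,
          List.length_singleton, pow_succ,
          listProd_cons, listProd_nil, mul_one, mul_right_comm]
      · exact funext fun p => E0_comm (hq p) _
      · exact ho.anticomm (gF_odd k)

end Substitution

/-! ### Values of `C_l` and `G_n` -/

section GeneratorValues

variable {K Z A : Type*} [Field K] [CommRing Z] [Ring A] [Algebra K Z] [Algebra K A] [Algebra Z A]
  [IsScalarTower K Z A] {a : ℕ → Z} {g b : ℕ → A}

theorem symMat_kPair_mul (h : IsSuper g b) (μ : List ℕ) (i j : ℕ) (m I J : List ℕ) :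
    symMat K A (kPair a g b μ [i] [j]) * symMat K A (kPair a g b m I J) =
      (-1 : K) ^ I.length • symMat K A (kPair a g b (μ ++ m) (i :: I) (j :: J)) := by
  obtain ⟨e1, e2⟩ := h.b_mul a j I
  rw [symMat_mul_symMat, ← map_smul]
  congr 1
  rcases Nat.even_or_odd I.length with hI | hI <;> rw [hI.neg_one_pow] at e1 e2 ⊢ <;>
  · simp only [kPair, listProd_cons, listProd_nil, koszul_cons, koszul_nil, mul_one, mul_zero,
      sub_zero, listProd_append,
      smul_mul_assoc, mul_smul_comm, one_mul, Prod.smul_mk, Prod.mk.injEq, mul_assoc, sub_mul]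
    rw [← mul_assoc (b j), ← mul_assoc (b j), e1, e2]
    simp only [smul_mul_assoc, mul_smul_comm, mul_assoc, neg_mul, mul_neg]
    constructor <;> module

variable (K) in
/-- The sign `∏_{k < n} (-1)^k` arising from `γ₁β₁ γ₂β₂ ⋯ γₙβₙ = ± γ₁⋯γₙ β₁⋯βₙ`. -/
def revSign (n : ℕ) : K := ∏ k ∈ Finset.range n, (-1 : K) ^ k

theorem revSign_ne_zero (n : ℕ) : revSign K n ≠ 0 :=
  Finset.prod_ne_zero_iff.2 fun _ _ => pow_ne_zero _ (neg_ne_zero.2 one_ne_zero)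

theorem prod_symMat_kPair (h : IsSuper g b) (τ : ℕ → ℕ) (κ : K) (L : List ℕ) :
    (L.map fun j => κ • symMat K A (kPair a g b [] [τ j] [j])).prod =
      (κ ^ L.length * revSign K L.length) • symMat K A (kPair a g b [] (L.map τ) L) := by
  induction L with
  | nil =>
    ext i j
    fin_cases i <;> fin_cases j <;> simp [symMat, kPair, revSign]
  | cons j L ih =>
    rw [List.map_cons, List.prod_cons, ih, smul_mul_smul_comm, symMat_kPair_mul h, List.map_cons,
      smul_smul, List.length_cons, List.length_map, revSign, revSign, Finset.prod_range_succ,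
      List.append_nil]
    congr 1
    ring

/-- The closed formula `∂γ_I = ∑_k (-1)^k a_{i_k} γ_{I ∖ i_k}` for the boundary. -/
theorem sum_listProd_eraseIdx (I : List ℕ) :
    ∑ k ∈ Finset.range I.length, (-1 : K) ^ k • a (I.getD k 0) • listProd g (I.eraseIdx k) =
      koszul a g I := by
  induction I with
  | nil => simp
  | cons i I ih =>
    rw [List.length_cons, Finset.sum_range_succ', koszul_cons, ← ih, Finset.mul_sum, add_comm,
      sub_eq_add_neg, ← Finset.sum_neg_distrib]
    congr 1
    · simp
    · refine Finset.sum_congr rfl fun k _ => ?_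
      simp only [List.getD_cons_succ, List.eraseIdx_cons_succ, listProd_cons, pow_succ,
        mul_smul_comm]
      module

/-- The relation `∂² = 0`, in the form given by `sum_listProd_eraseIdx`. -/
theorem sum_koszul_eraseIdx (I : List ℕ) :
    ∑ k ∈ Finset.range I.length, (-1 : K) ^ k • a (I.getD k 0) • koszul a g (I.eraseIdx k) = 0 := by
  induction I with
  | nil => simp
  | cons i I ih =>
    have e : ∀ k, (-1 : K) ^ (k + 1) • a ((i :: I).getD (k + 1) 0) •
        koszul a g ((i :: I).eraseIdx (k + 1)) =
        g i * ((-1 : K) ^ k • a (I.getD k 0) • koszul a g (I.eraseIdx k)) -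
          a i • ((-1 : K) ^ k • a (I.getD k 0) • listProd g (I.eraseIdx k)) := by
      intro k
      simp only [List.getD_cons_succ, List.eraseIdx_cons_succ, koszul_cons, pow_succ, mul_smul_comm]
      module
    rw [List.length_cons, Finset.sum_range_succ', Finset.sum_congr rfl fun k _ => e k,
      Finset.sum_sub_distrib, ← Finset.mul_sum, ih, ← Finset.smul_sum, sum_listProd_eraseIdx]
    simp

theorem sum_kPair_eraseIdx (I J : List ℕ) :
    ∑ k ∈ Finset.range I.length, (-1 : K) ^ k • kPair a g b [I.getD k 0] (I.eraseIdx k) J =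
      (koszul a g I * listProd b J, 0) := by
  refine Prod.ext ?_ ?_
  · rw [Prod.fst_sum, ← sum_listProd_eraseIdx (K := K), Finset.sum_mul]
    refine Finset.sum_congr rfl fun k _ => ?_
    simp [kPair]
  · rw [Prod.snd_sum]
    have := congrArg (· * listProd b J) (sum_koszul_eraseIdx (K := K) (a := a) (g := g) I)
    rw [zero_mul, Finset.sum_mul] at this
    rw [← this]
    refine Finset.sum_congr rfl fun k _ => ?_
    simp [kPair]

/-- Deleting the entry `i + 1` from `1, …, l + 1` leaves the sequence of the indices of the `z`s
attached to `y_2, …, y_{l+1}` in `P_{i+1}`. -/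
theorem eraseIdx_range' (l i : ℕ) (hi : i < l + 1) :
    (List.range' 1 (l + 1)).eraseIdx i =
      (List.range' 2 l).map fun j => if j ≤ i + 1 then j - 1 else j := by
  apply List.ext_getElem
  · rw [List.length_eraseIdx_of_lt (by simpa using hi)]; simp
  · intro k h1 h3
    rw [List.getElem_eraseIdx]
    simp only [List.getElem_range', List.getElem_map]
    split_ifs <;> omega

theorem four_ne_zero_of_two (h2 : (2 : K) ≠ 0) : (4 : K) ≠ 0 := by
  have := mul_ne_zero h2 h2
  norm_num at this
  exact this

variable (K) in
/-- The scalar, a sign times a power of two, relating `P_i` to the symmetric matrix of a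
Koszul pair. -/
def cSign (l : ℕ) : K := 4 * (-2) ^ (l - 1) * revSign K (l - 1) * (-1) ^ (l - 1)

theorem cSign_ne_zero (h2 : (2 : K) ≠ 0) (l : ℕ) : cSign K l ≠ 0 := by
  exact mul_ne_zero (mul_ne_zero (mul_ne_zero (four_ne_zero_of_two h2)
    (pow_ne_zero _ (neg_ne_zero.2 h2)))
    (revSign_ne_zero _)) (pow_ne_zero _ (neg_ne_zero.2 one_ne_zero))

section
variable (h : IsSuper g b) {p : ℕ → A} (hp : ∀ i x, p i * x = x * p i)
    (Ψ : StarPoly K →ₐ[K] Matrix (Fin 2) (Fin 2) A)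
    (hy : ∀ i, Ψ (y K i) = symMat K A (p i, b i)) (hz : ∀ i, Ψ (z K i) = skewMat K A (g i, a i • 1))
include h hp hy hz

theorem map_lie_yz (j k : ℕ) :
    Ψ ⁅y K j, z K k⁆ = (-2 : K) • symMat K A (kPair a g b [] [k] [j]) := by
  have : Ψ ⁅y K j, z K k⁆ = ⁅Ψ (y K j), Ψ (z K k)⁆ := by simp [Ring.lie_def]
  rw [this, hy, hz, symMat_lie_skewMat _ (hp _ _) (h.bg _ _), ← map_smul]
  congr 1
  simp only [kPair, listProd_cons, listProd_nil, koszul_cons, koszul_nil, mul_one, mul_zero,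
    sub_zero, neg_smul, two_smul,
    smul_mul_assoc, one_mul, Prod.mk.injEq, Prod.mk_add_mk, Prod.neg_mk]
  constructor <;> module

theorem map_lie_yzz (j i k : ℕ) :
    Ψ ⁅⁅y K j, z K i⁆, z K k⁆ = (4 : K) • symMat K A (kPair a g b [i] [k] [j]) := by
  have : Ψ ⁅⁅y K j, z K i⁆, z K k⁆ = ⁅Ψ ⁅y K j, z K i⁆, Ψ (z K k)⁆ := by simp [Ring.lie_def]
  rw [this, map_lie_yz h hp Ψ hy hz, hz, Ring.lie_def, smul_mul_assoc, mul_smul_comm, ← smul_sub,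
    ← Ring.lie_def, symMat_kPair_lie_skewMat h, smul_smul]
  norm_num

theorem map_P (l i : ℕ) (hl : 0 < l) (hi : i < l + 1) :
    Ψ (P K l (i + 1)) = cSign K l • symMat K A
      (kPair a g b [i + 1] ((List.range' 1 (l + 1)).eraseIdx i)
      (List.range' 2 l)) := by
  have hτ : Ψ (if i + 1 = 1 then ⁅⁅y K 2, z K 1⁆, z K 2⁆ else ⁅⁅y K 2, z K (i + 1)⁆, z K 1⁆) =
      (4 : K) • symMat K A (kPair a g b [i + 1] [if 2 ≤ i + 1 then 2 - 1 else 2] [2]) := by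
    split_ifs with h1 h3 h3
    · omega
    · rw [map_lie_yzz h hp Ψ hy hz, h1]
    · rw [map_lie_yzz h hp Ψ hy hz]
    · omega
  obtain ⟨l, rfl⟩ := Nat.exists_eq_succ_of_ne_zero hl.ne'
  have e := prod_symMat_kPair (a := a) h (fun j => if j ≤ i + 1 then j - 1 else j) (-2 : K)
    (List.range' 3 l)
  rw [P, map_mul, hτ, map_list_prod, List.map_map]
  have e' : (⇑Ψ ∘ fun j => ⁅y K j, z K (if j ≤ i + 1 then j - 1 else j)⁆) = fun j =>
      (-2 : K) • symMat K A (kPair a g b [] [if j ≤ i + 1 then j - 1 else j] [j]) :=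
    funext fun j => map_lie_yz h hp Ψ hy hz _ _
  rw [e', Nat.succ_eq_add_one, Nat.add_sub_cancel, e, smul_mul_smul_comm, symMat_kPair_mul h,
    smul_smul,
    eraseIdx_range' _ _ hi, List.range'_succ, List.map_cons, List.append_nil, cSign,
    Nat.add_sub_cancel]
  simp only [List.length_map, List.length_range']
  congr 1
  ring

/-- The value of `C_l` is, up to a nonzero scalar, the boundary of `γ_1 ⋯ γ_{l+1}` times
`β_2 ⋯ β_{l+1}`. The variables `y_i` may have any value with central diagonal, so that the
formula also gives the values of substitution instances. -/
theorem map_C (l : ℕ) (hl : 0 < l) :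
    Ψ (C K l) = (-cSign K l) •
      symMat K A (koszul a g (List.range' 1 (l + 1)) * listProd b (List.range' 2 l), 0) := by
  have e : ∀ i ∈ Finset.range (l + 1), Ψ ((-1) ^ (1 + i) * P K l (1 + i)) =
      (-cSign K l) • symMat K A ((-1 : K) ^ i • kPair a g b [(List.range' 1 (l + 1)).getD i 0]
        ((List.range' 1 (l + 1)).eraseIdx i) (List.range' 2 l)) := by
    intro i hi
    have hi := Finset.mem_range.1 hi
    have hg : (List.range' 1 (l + 1)).getD i 0 = i + 1 := by
      rw [List.getD_eq_getElem _ _ (by simpa using hi), List.getElem_range']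
      omega
    rw [hg, map_mul, add_comm 1 i, map_P h hp Ψ hy hz l i hl hi, map_pow, map_neg, map_one,
      map_smul, pow_succ]
    rcases Nat.even_or_odd i with h' | h' <;> rw [h'.neg_one_pow, h'.neg_one_pow] <;> simp
  have hsum : (Finset.Icc 1 (l + 1)) = (Finset.range (l + 1)).image (1 + ·) := by
    ext k
    simp only [Finset.mem_Icc, Finset.mem_image, Finset.mem_range]
    constructor
    · rintro ⟨h1, h3⟩; exact ⟨k - 1, by omega, by omega⟩
    · rintro ⟨k, h1, rfl⟩; omega
  rw [C, hsum, Finset.sum_image (fun _ _ _ _ h => Nat.add_left_cancel h), map_sum,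
    Finset.sum_congr rfl e, ← Finset.smul_sum, ← map_sum]
  congr 2
  have := sum_kPair_eraseIdx (K := K) (a := a) (g := g) (b := b) (List.range' 1 (l + 1))
    (List.range' 2 l)
  rwa [List.length_range'] at this

end

theorem jordan_value {c c' : Z} (γ γ' : A) :
    (2⁻¹ : K) • (skewMat K A (γ, c • 1) * skewMat K A (γ', c' • 1) +
      skewMat K A (γ', c' • 1) * skewMat K A (γ, c • 1)) =
    (2⁻¹ : K) • (2 : K) • symMat K A ((c * c') • 1, 0) := by
  congr 1
  rw [skewMat_mul_skewMat, skewMat_mul_skewMat]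
  ext i j
  fin_cases i <;> fin_cases j <;> simp [skewMat, symMat, two_smul] <;> module

theorem map_jordan (h2 : (2 : K) ≠ 0) {Ψ : StarPoly K →ₐ[K] Matrix (Fin 2) (Fin 2) A}
    {u v : StarPoly K} {γ γ' : A} {c c' : Z} (hu : Ψ u = skewMat K A (γ, c • 1))
    (hv : Ψ v = skewMat K A (γ', c' • 1)) : Ψ (jordan u v) = symMat K A ((c * c') • 1, 0) := by
  rw [jordan, map_smul, map_add, map_mul, map_mul, hu, hv, jordan_value, smul_smul,
    inv_mul_cancel₀ h2, one_smul]

theorem map_G (h2 : (2 : K) ≠ 0) (Ψ : StarPoly K →ₐ[K] Matrix (Fin 2) (Fin 2) A)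
    (hz : ∀ i, Ψ (z K i) = skewMat K A (g i, a i • 1)) (n : ℕ) :
    Ψ (G K n) = symMat K A (listProd a (List.range' 1 (2 * n)) • 1, 0) := by
  induction n with
  | zero =>
    ext i j
    fin_cases i <;> fin_cases j <;> simp [G, symMat]
  | succ n ih =>
    have e : G K (n + 1) = G K n * jordan (z K (2 * n + 1)) (z K (2 * n + 2)) := by
      simp [G, List.range_succ]
    rw [e, map_mul, ih, map_jordan h2 (hz _) (hz _), symMat_mul_symMat, mul_add, mul_one,
      List.range'_append_1.symm, listProd_append]
    simp only [List.range', listProd_cons, listProd_nil, mul_one, smul_mul_smul_comm, mul_zero,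
      zero_mul,
      add_zero]
    rw [add_comm 1 (2 * n)]

end GeneratorValues

/-! ### Realization of Koszul boundaries in `W` and `V` -/

section Realization

variable {K : Type*} [Field K]

theorem listProd_comp {B : Type*} [Monoid B] (f : ℕ → B) (τ : ℕ → ℕ) (l : List ℕ) :
    listProd (fun k => f (τ k)) l = listProd f (l.map τ) := by
  rw [listProd, listProd, List.map_map]; rfl

theorem koszul_comp {Z A : Type*} [CommRing Z] [Ring A] [Algebra Z A] (a : ℕ → Z) (g : ℕ → A)
    (τ : ℕ → ℕ) (l : List ℕ) :
    koszul (fun k => a (τ k)) (fun k => g (τ k)) l = koszul a g (l.map τ) := by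
  induction l with
  | nil => rfl
  | cons i l ih => rw [koszul_cons, listProd_comp, ih, List.map_cons, koszul_cons]

theorem map_getD_range' (s : ℕ) (L : List ℕ) :
    (List.range' s L.length).map (fun k => L.getD (k - s) 0) = L := by
  apply List.ext_getElem
  · simp
  · intro k h1 h3
    simp [List.getElem?_eq_getElem h3]

theorem listProd_smul {A : Type*} [Ring A] [Algebra K A] (c : K) (f : ℕ → A) (l : List ℕ) :
    listProd (fun k => c • f k) l = c ^ l.length • listProd f l := by
  induction l with
  | nil => simp
  | cons i l ih => rw [listProd_cons, ih, smul_mul_smul_comm, listProd_cons, List.length_cons,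
      pow_succ']

/-- Even products of the `a_i` are values of substitution instances of `G_n`. -/
theorem exists_W_even (h2 : (2 : K) ≠ 0) {L : List ℕ} (hL : Even L.length) (hL' : L ≠ []) :
    ∃ f ∈ W K, evalMat K f = symMat K (Fn K) (listProd (aC K) L • 1, 0) := by
  obtain ⟨n, hn⟩ := hL
  let τ : ℕ → ℕ := fun k => L.getD (k - 1) 0
  let φ := subst (y K) (fun k => z K (τ k))
  have hn0 : 0 < n := by
    have := List.length_pos_iff.2 hL'
    omega
  refine ⟨φ (G K n), starSpan_map (subst_canInv canInv_y fun _ => canInv_z _)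
    (subset_starSpan (Or.inl (Or.inl ⟨n, hn0, rfl⟩))), ?_⟩
  have hz : ∀ i, (evalMat K).comp φ (z K i) = skewMat K (Fn K) (gF K (τ i), aC K (τ i) • 1) :=
      fun i => by
    rw [AlgHom.comp_apply, subst_z h2, evalMat_z h2]
  have := map_G (a := fun k => aC K (τ k)) (g := fun k => gF K (τ k)) h2 _ hz n
  rw [AlgHom.comp_apply, listProd_comp, two_mul, ← hn, map_getD_range'] at this
  exact this

/-- Boundaries with at least one `β` are values of substitution instances of `C_l`: the indices are
renamed, and `y_2` is replaced by a commutator of `y_j` with the `z_k`, `k ∈ m`, which brings in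
the factor `a_m`. -/
theorem exists_W_cyc (h2 : (2 : K) ≠ 0) (m I J : List ℕ) (j : ℕ)
    (hI : I.length = J.length + 2) : ∃ f ∈ W K,
    evalMat K f = symMat K (Fn K) (listProd (aC K) m •
      (koszul (aC K) (gF K) I * listProd (bF K) (j :: J)), 0) := by
  let σ : ℕ → ℕ := fun k => (j :: J).getD (k - 2) 0
  let τ : ℕ → ℕ := fun k => I.getD (k - 1) 0
  -- Only `y_2` is replaced by a proper commutator.
  let μ : ℕ → List ℕ := fun k => if k = 2 then m else []
  let b' : ℕ → Fn K := fun k =>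
    ((-2 : K) ^ (μ k).length * 2⁻¹) • listProd (aC K) (μ k) • bF K (σ k)
  choose p hp hs using fun k => evalMat_leftComm h2 (σ k) (μ k)
  let φ := subst (fun k => leftComm (y K (σ k)) ((μ k).map (z K))) (fun k => z K (τ k))
  have hφ : ∀ f, φ (canInv f) = canInv (φ f) :=
    subst_canInv (fun _ => canInv_leftComm _ _) fun _ => canInv_z _
  have hsup : IsSuper (fun k => gF K (τ k)) b' :=
    isSuper_of_odd h2 (fun _ => gF_odd _) fun _ => (bF_odd _).smul _ _
  have hz : ∀ i, (evalMat K).comp φ (z K i) = skewMat K (Fn K) (gF K (τ i), aC K (τ i) • 1) :=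
      fun i => by
    rw [AlgHom.comp_apply, subst_z h2, evalMat_z h2]
  have hy : ∀ i, (evalMat K).comp φ (y K i) = symMat K (Fn K) (p i, b' i) := fun i => by
    rw [AlgHom.comp_apply, subst_y h2, hs]
  have key := map_C (a := fun k => aC K (τ k)) hsup
    (fun i x => funext fun q => E0_comm (hp i q) (x q)) _ hy hz (J.length + 1) (Nat.succ_pos _)
  have hb : listProd b' (List.range' 2 (J.length + 1)) =
      ((-2 : K) ^ m.length * 2⁻¹ * 2⁻¹ ^ J.length) • listProd (aC K) m • listProd (bF K)
        (j :: J) := by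
    have h1 : listProd b' (List.range' 3 J.length) = (2⁻¹ : K) ^ J.length • listProd (bF K) J := by
      have h3 : listProd b' (List.range' 3 J.length) =
          listProd (fun k => (2⁻¹ : K) • bF K (J.getD (k - 3) 0)) (List.range' 3 J.length) := by
        refine listProd_congr fun k hk => ?_
        have hk : 3 ≤ k := by simp at hk; omega
        obtain ⟨k, rfl⟩ := Nat.exists_eq_add_of_le' hk
        simp [b', μ, σ]
      rw [h3, listProd_smul, List.length_range', listProd_comp, map_getD_range']
    rw [List.range'_succ, listProd_cons, h1, listProd_cons]
    simp only [b', μ, σ, if_true, Nat.sub_self, List.getD_cons_zero]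
    rw [mul_smul_comm, smul_mul_assoc, smul_mul_assoc, smul_smul, mul_comm (2⁻¹ ^ J.length : K)]
  have hd := koszul_comp (aC K) (gF K) τ (List.range' 1 (J.length + 1 + 1))
  have hr : (List.range' 1 (J.length + 1 + 1)).map τ = I := by
    rw [show J.length + 1 + 1 = I.length by omega, map_getD_range']
  rw [hr] at hd
  rw [hb, hd, mul_smul_comm, mul_smul_comm] at key
  have h0 : -cSign K (J.length + 1) * ((-2 : K) ^ m.length * 2⁻¹ * 2⁻¹ ^ J.length) ≠ 0 :=
    mul_ne_zero (neg_ne_zero.2 (cSign_ne_zero h2 _)) (mul_ne_zero (mul_ne_zero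
      (pow_ne_zero _ (neg_ne_zero.2 h2)) (inv_ne_zero h2)) (pow_ne_zero _ (inv_ne_zero h2)))
  refine ⟨(-cSign K (J.length + 1) * ((-2 : K) ^ m.length * 2⁻¹ * 2⁻¹ ^ J.length))⁻¹ •
    φ (C K (J.length + 1)), Submodule.smul_mem _ _ (starSpan_map hφ
      (subset_starSpan (Or.inl (Or.inr ⟨_, Nat.succ_pos _, rfl⟩)))), ?_⟩
  have e : ∀ (κ : K) (x : Fn K), symMat K (Fn K) (κ • x, 0) = κ • symMat K (Fn K) (x, 0) :=
      fun κ x => by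
    rw [← map_smul, Prod.smul_mk, smul_zero]
  rw [map_smul, ← AlgHom.comp_apply, key, e, smul_smul, smul_smul, mul_assoc,
    inv_mul_cancel₀ h0, one_smul]

theorem identities_le_V : identities K ≤ V K := fun _ hf =>
  subset_starSpan (Or.inl (Or.inl hf))

theorem jordan_mem_V (h2 : (2 : K) ≠ 0) {u v : StarPoly K} (hu : canInv u = -u)
    (hv : canInv v = -v) : jordan u v ∈ V K := by
  have h : jordan (z K 1) (z K 2) ∈ V K := subset_starSpan (Or.inl (Or.inr (Or.inl rfl)))
  have := starSpan_map (φ := subst (y K) (fun k => if k = 1 then u else v))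
    (subst_canInv canInv_y fun k => by split_ifs <;> assumption) h
  rw [jordan, map_smul, map_add, map_mul, map_mul, subst_z h2, subst_z h2] at this
  exact this

/-- Antisymmetrizing the generator `[y, z, z'] - 4 (z ∘ z') y` in `z` and `z'` removes its second
term. -/
theorem lie_lie_sub_mem_V (h2 : (2 : K) ≠ 0) {s u v : StarPoly K} (hs : canInv s = s)
    (hu : canInv u = -u) (hv : canInv v = -v) : ⁅⁅s, u⁆, v⁆ - ⁅⁅s, v⁆, u⁆ ∈ V K := by
  have h : ⁅⁅y K 1, z K 1⁆, z K 2⁆ - (4 : K) • (jordan (z K 1) (z K 2) * y K 1) ∈ V K :=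
    subset_starSpan (Or.inl (Or.inr (Or.inr rfl)))
  have key : ∀ u v : StarPoly K, canInv u = -u → canInv v = -v →
      ⁅⁅s, u⁆, v⁆ - (4 : K) • (jordan u v * s) ∈ V K := by
    intro u v hu hv
    have := starSpan_map (φ := subst (fun _ => s) (fun k => if k = 1 then u else v))
      (subst_canInv (fun _ => hs) fun k => by split_ifs <;> assumption) h
    rw [Ring.lie_def, Ring.lie_def, jordan] at this
    simp only [map_sub, map_mul, map_smul, map_add, subst_z h2, subst_y h2] at this
    exact this
  have hj : jordan u v = jordan v u := by rw [jordan, jordan, add_comm]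
  have := sub_mem (key u v hu hv) (key v u hv hu)
  rwa [hj, sub_sub_sub_cancel_right] at this

theorem evalMat_prod_z (h2 : (2 : K) ≠ 0) (L : List ℕ) :
    evalMat K (L.map (z K)).prod 0 1 = 0 ∧
    evalMat K (L.map (z K)).prod 0 0 = listProd (aC K) L • (1 : Fn K) ∧
    evalMat K (L.map (z K)).prod 1 1 = (-1 : K) ^ L.length • listProd (aC K) L • (1 : Fn K) := by
  induction L with
  | nil => simp
  | cons i L ih =>
    obtain ⟨h1, h3, h4⟩ := ih
    rw [List.map_cons, List.prod_cons, map_mul, evalMat_z h2]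
    simp only [Matrix.mul_apply, Fin.sum_univ_two, h1, h3, h4]
    refine ⟨by simp [skewMat], ?_, ?_⟩
    · simp [skewMat, mul_smul, smul_comm (listProd (aC K) L)]
    · simp only [skewMat, LinearMap.coe_mk, AddHom.coe_mk, Matrix.of_apply, Matrix.cons_val',
        Matrix.cons_val_zero, Matrix.cons_val_one, Matrix.cons_val_fin_one, mul_zero, zero_add,
        neg_mul, smul_mul_assoc, one_mul, listProd_cons, List.length_cons, pow_succ,
          mul_neg, mul_one,
        neg_smul, mul_smul]
      rw [smul_comm]

/-- Even products of the `a_i` are values of `z_i ∘ u`, where `u` is the skew part of a product of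
an odd number of `z`s. -/
theorem exists_V_even (h2 : (2 : K) ≠ 0) {L : List ℕ} (hL : Even L.length) (hL' : L ≠ []) :
    ∃ f ∈ V K, evalMat K f = symMat K (Fn K) (listProd (aC K) L • 1, 0) := by
  obtain ⟨i, L, rfl⟩ := List.exists_cons_of_ne_nil hL'
  refine ⟨_, jordan_mem_V h2 (canInv_z i) (canInv_skewPart (L.map (z K)).prod), ?_⟩
  obtain ⟨h1, h3, h4⟩ := evalMat_prod_z h2 L
  have hodd : Odd L.length := by
    rw [List.length_cons, Nat.even_add_one, Nat.not_even_iff_odd] at hL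
    exact hL
  have hv := evalMat_skewPart h2 (L.map (z K)).prod
  rw [h3, h4, hodd.neg_one_pow, neg_one_smul, sub_neg_eq_add, ← two_smul K, smul_smul,
    inv_mul_cancel₀ h2, one_smul] at hv
  rw [map_jordan h2 (evalMat_z h2 i) hv, listProd_cons]

theorem exists_symMat_kPair (h2 : (2 : K) ≠ 0) (I J : List ℕ) (h : I.length = J.length) :
    ∃ f, evalMat K f = symMat K (Fn K) (kPairE K [] I J) := by
  induction J generalizing I with
  | nil =>
    obtain rfl : I = [] := by simpa using h
    refine ⟨1, ?_⟩
    rw [map_one]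
    ext i j
    fin_cases i <;> fin_cases j <;> simp [symMat, kPair]
  | cons j J ih =>
    obtain ⟨i, I, rfl⟩ := List.exists_of_length_succ I h
    obtain ⟨f, hf⟩ := ih I (by simpa using h)
    refine ⟨(-(-1 : K) ^ I.length) • (⁅y K j, z K i⁆ * f), ?_⟩
    have e : evalMat K ⁅y K j, z K i⁆ = -symMat K (Fn K) (kPairE K [] [i] [j]) := by
      have : evalMat K ⁅y K j, z K i⁆ = ⁅evalMat K (y K j), evalMat K (z K i)⁆ := by
        simp [Ring.lie_def]
      rw [this, evalMat_y h2, evalMat_z h2, yMat_lie_skewMat _ _ ((isSuper_std h2).bg _ _)]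
      simp [kPair]
    rw [map_smul, map_mul, e, hf, neg_mul, symMat_kPair_mul (isSuper_std h2), smul_neg,
      neg_smul, neg_neg,
      smul_smul, ← mul_pow]
    simp

/-- The skew part of `z_i [y, z] [y, z] ⋯` takes, up to sign,
the value given by a single Koszul pair. -/
theorem exists_skew_skewMat_kPair (h2 : (2 : K) ≠ 0) (I J : List ℕ) (h : I.length = J.length + 1) :
    ∃ u, canInv u = -u ∧ evalMat K u = skewMat K (Fn K) (kPairE K [] I J) := by
  obtain ⟨i, I, rfl⟩ := List.exists_of_length_succ I h
  obtain ⟨f, hf⟩ := exists_symMat_kPair h2 I J (by simpa using h)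
  refine ⟨_, canInv_skewPart (z K i * f), ?_⟩
  rw [evalMat_skewPart h2, map_mul, hf, evalMat_z h2]
  have e := skewMat_mul_symMat (K := K) (gF K i) (aC K i) (kPairE K [] I J)
  rw [e]
  congr 1
  refine Prod.ext ?_ ?_
  · simp [symMat, skewMat, kPair, mul_assoc]
  · have half : ∀ x y : Fn K, (2⁻¹ : K) • (x + y - (x + -y)) = y := fun x y => by
      rw [add_sub_add_left_eq_sub, sub_neg_eq_add, ← two_smul K, smul_smul, inv_mul_cancel₀ h2,
        one_smul]
    simp only [symMat, skewMat, Matrix.add_apply, LinearMap.coe_mk, AddHom.coe_mk, Matrix.of_apply,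
      Matrix.cons_val', Matrix.cons_val_zero, Matrix.cons_val_one, Matrix.cons_val_fin_one]
    rw [half]
    simp [kPair, sub_mul, mul_assoc]

/-- For `s` symmetric and `u`, `v` skew, the value of `[s, u, v] - [s, v, u]` is
`4 (c r - c' γ) q`, where `(γ, c)`, `(r, c')` and `q` are the entries of `u`, `v` and `s`. If
`c = ∂γ` and `c' = ∂r` this is `4 ∂(γ r) q`. -/
theorem lie_lie_sub_value {Z A : Type*} [CommRing Z] [Ring A] [Algebra K Z] [Algebra K A]
    [Algebra Z A] [IsScalarTower K Z A] {p q γ r : A} (c c' : Z) (hpγ : p * γ = γ * p)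
    (hpr : p * r = r * p) (hqγ : q * γ = -(γ * q)) (hqr : q * r = -(r * q))
    (hγr : γ * r = -(r * γ)) :
    ⁅⁅symMat K A (p, q), skewMat K A (γ, c • 1)⁆, skewMat K A (r, c' • 1)⁆ -
      ⁅⁅symMat K A (p, q), skewMat K A (r, c' • 1)⁆, skewMat K A (γ, c • 1)⁆ =
    (4 : K) • symMat K A ((c • r - c' • γ) * q, 0) := by
  have h1 : γ * q * r = r * (γ * q) := by
    rw [mul_assoc, hqr, mul_neg, ← mul_assoc, hγr, neg_mul, neg_neg, mul_assoc]
  have h3 : r * q * γ = γ * (r * q) := by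
    rw [mul_assoc, hqγ, mul_neg, ← mul_assoc, ← mul_assoc, hγr, neg_mul]
  rw [symMat_lie_skewMat c hpγ hqγ, symMat_lie_skewMat c' hpr hqr, symMat_lie_skewMat c',
    symMat_lie_skewMat c, ← map_sub, ← map_smul]
  · have h4 : (4 : K) = 2 * 2 := by norm_num
    congr 1
    simp only [h4, mul_smul, two_smul, Prod.mk_sub_mk, Prod.mk.injEq, sub_mul,
      smul_mul_assoc, mul_neg, mul_smul_comm, mul_add, add_zero, Prod.mk_add_mk]
    constructor <;> module
  · simp only [neg_mul, mul_neg, add_mul, mul_add, h3]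
  · simp only [neg_mul, mul_neg, smul_mul_assoc, mul_smul_comm, add_mul, mul_add, hqγ]
    module
  · simp only [neg_mul, mul_neg, add_mul, mul_add, h1]
  · simp only [neg_mul, mul_neg, smul_mul_assoc, mul_smul_comm, add_mul, mul_add, hqr]
    module

variable (K) in
/-- All values of `f` have parity `n`. -/
def IsParityFn (n : ZMod 2) (f : Fn K) : Prop :=
  ∀ p, f p ∈ CliffordAlgebra.evenOdd (0 : QuadraticForm K (ℕ →₀ K)) n

theorem IsParityFn.mul {n n' : ZMod 2} {f f' : Fn K} (h : IsParityFn K n f)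
    (h' : IsParityFn K n' f') : IsParityFn K (n + n') (f * f') := fun p =>
  CliffordAlgebra.evenOdd_mul_le _ n n' (Submodule.mul_mem_mul (h p) (h' p))

theorem isParityFn_listProd {f : ℕ → Fn K} (h : ∀ i, IsOddFn (f i)) (l : List ℕ) :
    IsParityFn K l.length (listProd f l) := by
  induction l with
  | nil =>
    have h1 := algebraMap_mem_E0 K 1
    rw [map_one] at h1
    rw [List.length_nil, Nat.cast_zero]
    exact fun _ => h1
  | cons i l ih =>
    have := IsParityFn.mul (h i : IsParityFn K 1 (f i)) ih
    rw [listProd_cons, List.length_cons, Nat.cast_add, Nat.cast_one, add_comm]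
    exact this

theorem isParityFn_koszul (l : List ℕ) : IsParityFn K (l.length + 1) (koszul (aC K) (gF K) l) := by
  induction l with
  | nil => exact fun p => zero_mem _
  | cons i l ih =>
    have h1 := IsParityFn.mul (aE_even i : IsParityFn K 0 (aE K i)) (isParityFn_listProd gF_odd l)
    have h3 := IsParityFn.mul (gF_odd i : IsParityFn K 1 (gF K i)) ih
    have e : ∀ x : ZMod 2, x + 1 + 1 = 0 + x ∧ x + 1 + 1 = 1 + (x + 1) := by decide
    rw [koszul_cons, List.length_cons, Nat.cast_add, Nat.cast_one]
    refine fun p => sub_mem ?_ ?_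
    · rw [(e _).1]; exact h1 p
    · rw [(e _).2]; exact h3 p

/-- Boundaries with at least one `β` are values of elements of `V`: use `[s, u, v] - [s, v, u]` with
`u = z_i`, with `s` a commutator of `y_j` and `z`s that provides `a_m β_j`, and with `v` a skew
element whose value is the Koszul pair of the other `γ`s and `β`s. The rule
`a_i γ_I - (∂γ_I) γ_i = ∂(γ_i γ_I)` for odd `γ_I` assembles the boundary. -/
theorem exists_V_cyc (h2 : (2 : K) ≠ 0) (m I J : List ℕ) (j : ℕ)
    (hI : I.length = J.length + 2) : ∃ f ∈ V K,
    evalMat K f = symMat K (Fn K) (listProd (aC K) m •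
      (koszul (aC K) (gF K) I * listProd (bF K) (J ++ [j])), 0) := by
  obtain ⟨i, I, rfl⟩ := List.exists_of_length_succ I hI
  have hI : I.length = J.length + 1 := by simpa using hI
  obtain ⟨u, hu, hu'⟩ := exists_skew_skewMat_kPair h2 I J hI
  obtain ⟨p, hp, hs⟩ := evalMat_leftComm h2 j m
  have hr : IsOddFn (kPairE K [] I J).1 := by
    have := (isParityFn_listProd gF_odd I).mul (isParityFn_listProd (bF_odd (K := K)) J)
    have e : ∀ x : ZMod 2, x + 1 + x = 1 := by decide
    rw [hI, Nat.cast_add, Nat.cast_one, e] at this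
    have h : IsOddFn (listProd (gF K) I * listProd (bF K) J) := this
    simpa [kPair] using h
  have ht : IsEvenFn (kPairE K [] I J).2 := by
    have := (isParityFn_koszul I).mul (isParityFn_listProd (bF_odd (K := K)) J)
    have e : ∀ x : ZMod 2, x + 1 + 1 + x = 0 := by decide
    rw [hI, Nat.cast_add, Nat.cast_one, e] at this
    have h : IsEvenFn (koszul (aC K) (gF K) I * listProd (bF K) J) := this
    simpa [kPair] using h
  have htc : (kPairE K [] I J).2 = ht.toCenter • 1 := by rw [IsEvenFn.toCenter_smul, mul_one]
  have hq := (bF_odd (K := K) j).smul ((-2 : K) ^ m.length * 2⁻¹) m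
  have key := lie_lie_sub_value (K := K) (aC K i) ht.toCenter
    (funext fun x => E0_comm (hp x) (gF K i x)) (funext fun x => E0_comm (hp x) _)
    (hq.anticomm (gF_odd i)) (hq.anticomm hr) ((gF_odd i).anticomm hr)
  have hv : aC K i • (kPairE K [] I J).1 - ht.toCenter • gF K i =
      koszul (aC K) (gF K) (i :: I) * listProd (bF K) J := by
    have e : (kPairE K [] I J).2 * gF K i = gF K i * (kPairE K [] I J).2 :=
      funext fun x => E0_comm (ht x) _
    rw [IsEvenFn.toCenter_smul, e, koszul_cons, sub_mul, smul_mul_assoc, mul_assoc]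
    simp only [kPair, listProd_nil, one_smul]
  have h0 : (4 : K) * ((-2 : K) ^ m.length * 2⁻¹) ≠ 0 :=
    mul_ne_zero (four_ne_zero_of_two h2) (mul_ne_zero (pow_ne_zero _ (neg_ne_zero.2 h2))
      (inv_ne_zero h2))
  refine ⟨((4 : K) * ((-2 : K) ^ m.length * 2⁻¹))⁻¹ • _, Submodule.smul_mem _ _
    (lie_lie_sub_mem_V h2 (canInv_leftComm j m) (canInv_z i) hu), ?_⟩
  have e : ∀ (κ : K) (x : Fn K), symMat K (Fn K) (κ • x, 0) = κ • symMat K (Fn K) (x, 0) :=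
      fun κ x => by
    rw [← map_smul, Prod.smul_mk, smul_zero]
  have hlie : ∀ f f' : StarPoly K, evalMat K ⁅f, f'⁆ = ⁅evalMat K f, evalMat K f'⁆ := fun f f' => by
    simp [Ring.lie_def]
  have hu'' : evalMat K u = skewMat K (Fn K) ((kPairE K [] I J).1, ht.toCenter • 1) := by
    rw [hu', ← htc]
  rw [map_smul, map_sub, hlie, hlie, hlie, hlie, hs, hu'', evalMat_z h2, key, hv, mul_smul_comm,
    mul_smul_comm, e, smul_smul, smul_smul, mul_assoc, inv_mul_cancel₀ h0, one_smul, mul_assoc,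
    listProd_append, listProd_cons, listProd_nil, mul_one]

theorem evalMat_algebraMap (r : K) :
    evalMat K (algebraMap K (StarPoly K) r) = symMat K (Fn K) (r • 1, 0) := by
  rw [AlgHom.commutes]
  ext i j
  fin_cases i <;> fin_cases j <;> simp [symMat, Matrix.algebraMap_matrix_apply, Algebra.smul_def]

/-- An element `c` of `cyc` is the sum of a scalar, its value at the zero point, and of the value of
an element of `W` as well as of an element of `V`. -/
theorem cyc_realization (h2 : (2 : K) ≠ 0) (c : Fn K) (hc : c ∈ cyc K) : ∃ r : K,
    c 0 = algebraMap K _ r ∧ (∃ f ∈ W K, evalMat K f = symMat K (Fn K) (c - r • 1, 0)) ∧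
      ∃ f ∈ V K, evalMat K f = symMat K (Fn K) (c - r • 1, 0) := by
  have s0 : symMat K (Fn K) (0, 0) = 0 := map_zero _
  induction hc using span_induction with
  | zero => exact ⟨0, by simp, ⟨0, zero_mem _, by simp [s0]⟩, ⟨0, zero_mem _, by simp [s0]⟩⟩
  | add x x' _ _ hx hx' =>
    obtain ⟨r, h0, ⟨f, hf, ef⟩, ⟨g, hg, eg⟩⟩ := hx
    obtain ⟨r', h0', ⟨f', hf', ef'⟩, ⟨g', hg', eg'⟩⟩ := hx'
    have e : ((x + x' - (r + r') • 1, 0) : Fn K × Fn K) = (x - r • 1, 0) + (x' - r' • 1, 0) := by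
      refine Prod.ext ?_ (by simp)
      simp only [Prod.fst_add, add_smul]
      abel
    refine ⟨r + r', by rw [Pi.add_apply, h0, h0', map_add], ⟨f + f', add_mem hf hf', ?_⟩,
      ⟨g + g', add_mem hg hg', ?_⟩⟩
    · rw [map_add, ef, ef', e, map_add]
    · rw [map_add, eg, eg', e, map_add]
  | smul k x _ hx =>
    obtain ⟨r, h0, ⟨f, hf, ef⟩, ⟨g, hg, eg⟩⟩ := hx
    have e : ((k • x - (k * r) • 1, 0) : Fn K × Fn K) = k • (x - r • 1, 0) := by
      refine Prod.ext ?_ (by simp)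
      simp only [Prod.smul_fst, smul_sub, mul_smul]
    refine ⟨k * r, by rw [Pi.smul_apply, h0, map_mul, Algebra.smul_def],
      ⟨k • f, Submodule.smul_mem _ _ hf, ?_⟩, ⟨k • g, Submodule.smul_mem _ _ hg, ?_⟩⟩
    · rw [map_smul, ef, e, map_smul]
    · rw [map_smul, eg, e, map_smul]
  | mem x hx =>
    rcases hx with ⟨m, I, J, hl, hJ, rfl⟩ | rfl
    · refine ⟨0, ?_, ?_⟩
      · obtain ⟨i, I, rfl⟩ := List.exists_of_length_succ I hl
        -- Boundaries vanish at the zero point.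
        have h0 : koszul (aC K) (gF K) (i :: I) 0 = 0 := by
          change aE K i 0 * _ - gF K i 0 * _ = 0
          have h1 : aE K i 0 = 0 := by simp [aE]
          have h3 : gF K i 0 = 0 := by simp [gF]
          rw [h1, h3, zero_mul, zero_mul, sub_zero]
        rw [center_smul_apply, Pi.mul_apply, h0, zero_mul, mul_zero, map_zero]
      · simp only [zero_smul, sub_zero]
        by_cases hJ0 : J = []
        · subst hJ0
          obtain ⟨i, rfl⟩ : ∃ i, I = [i] := List.length_eq_one_iff.1 (by simpa using hl)
          have e : listProd (aC K) m • (koszul (aC K) (gF K) [i] * listProd (bF K) []) =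
              listProd (aC K) (i :: m) • (1 : Fn K) := by
            simp only [koszul_cons, koszul_nil, listProd_nil, listProd_cons, mul_one, mul_zero,
              sub_zero, smul_smul,
              mul_comm (listProd (aC K) m)]
          have hev : Even (i :: m).length := by simpa using (hJ rfl).add_one
          rw [e]
          exact ⟨exists_W_even h2 hev (by simp), exists_V_even h2 hev (by simp)⟩
        · constructor
          · obtain ⟨j, J, rfl⟩ := List.exists_cons_of_ne_nil hJ0
            exact exists_W_cyc h2 m I J j (by simpa using hl)
          · obtain ⟨J', j, rfl⟩ := (List.eq_nil_or_concat J).resolve_left hJ0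
            rw [List.concat_eq_append] at hl ⊢
            exact exists_V_cyc h2 m I J' j (by simpa using hl)
    · exact ⟨1, by simp, ⟨0, zero_mem _, by simp [s0]⟩, ⟨0, zero_mem _, by simp [s0]⟩⟩

/-- In odd characteristic `p`, the substitution `y_1 ↦ 1` in `y_1^p` puts the scalars into `V`. -/
theorem algebraMap_mem_V (hp : 2 < ringChar K) (r : K) : algebraMap K (StarPoly K) r ∈ V K := by
  have h2 : (2 : K) ≠ 0 := Ring.two_ne_zero hp.ne'
  have h : y K 1 ^ ringChar K ∈ V K := subset_starSpan (Or.inr ⟨hp, rfl⟩)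
  have h1 : canInv (1 : StarPoly K) = 1 := by simpa using canInv_algebraMap (K := K) 1
  have h0 : canInv (0 : StarPoly K) = -0 := by simpa using canInv_algebraMap (K := K) 0
  have := starSpan_map (φ := subst (fun _ => 1) (fun _ => 0))
    (subst_canInv (fun _ => h1) fun _ => h0) h
  rw [map_pow, subst_y h2, one_pow] at this
  rw [Algebra.algebraMap_eq_smul_one]
  exact Submodule.smul_mem _ _ this

/-- Evaluation at the zero point gives the constant term. -/
theorem evalAt_zero (f : StarPoly K) :
    evalAt 0 f = algebraMap K (M11 K) (FreeAlgebra.algebraMapInv f) := by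
  have h : evalAt (K := K) 0 = (Algebra.ofId K (M11 K)).comp FreeAlgebra.algebraMapInv := by
    refine FreeAlgebra.hom_ext (funext fun x => ?_)
    have h0 : inv11 (0 : M11 K) = 0 := by
      apply Subtype.ext
      ext r s
      fin_cases r <;> fin_cases s <;> simp [inv11]
    rcases x with i | i <;> simp [evalAt, FreeAlgebra.algebraMapInv, h0]
  rw [h]
  rfl

end Realization

end StarM11

end

theorem corollary4p6 {K : Type*} [Field K] [Infinite K] (hchar : ringChar K ≠ 2)
    (w : StarM11.StarPoly K)
    (hproper : w ∈ StarM11.properAlg K)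
    (hcentral : w ∈ StarM11.centralPolys K) :
    (FreeAlgebra.algebraMapInv w = 0 →
      (∃ g ∈ StarM11.W K, w - g ∈ StarM11.identities K) ∧ w ∈ StarM11.V K) ∧
    (2 < ringChar K → w ∈ StarM11.V K) := by
  open StarM11 in
  have h2 : (2 : K) ≠ 0 := Ring.two_ne_zero hchar
  obtain ⟨c, hc, hw⟩ := central_value h2 hproper hcentral
  obtain ⟨r, hr, ⟨f, hf, ef⟩, ⟨g, hg, eg⟩⟩ := cyc_realization h2 c hc
  have key : ∀ f : StarPoly K, evalMat K f = symMat K (Fn K) (c - r • 1, 0) →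
      w - f - algebraMap K _ r ∈ identities K := by
    intro f ef
    rw [mem_identities_iff, map_sub, map_sub, hw, ef, evalMat_algebraMap, ← map_sub, ← map_sub]
    simp
  have hV : w - algebraMap K _ r ∈ V K := by
    have := add_mem (identities_le_V (key g eg)) hg
    rwa [sub_right_comm, sub_add_cancel] at this
  constructor
  · intro h0
    have hr0 : r = 0 := by
      -- The upper left entry of the value at the zero point.
      have h1 : evalMat K w 0 0 0 = 0 := by
        rw [evalMat_apply, evalAt_zero, h0, map_zero]
        rfl
      rw [hw] at h1
      have h3 : algebraMap K (Grassmann K) r = 0 := hr.symm.trans h1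
      exact (ExteriorAlgebra.algebraMap_eq_zero_iff _ r).1 h3
    rw [hr0, map_zero, sub_zero] at hV
    refine ⟨⟨f, hf, ?_⟩, hV⟩
    have := key f ef
    rwa [hr0, map_zero, sub_zero] at this
  · intro hp
    have := add_mem hV (algebraMap_mem_V hp r)
    rwa [sub_add_cancel] at this
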